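/- Let $n\ge 1$ and $\lambda=(\lambda_1,\dots,\lambda_n)\in(-1/2,\infty)^n$, and let $d\mu_\lambda(x)=\prod_{j=1}^n x_j^{2\lambda_j}\,dx_j$ on $(0,\infty)^n$. For $s,u,v>0$ and $\alpha>-1/2$ let $$L_s^{\alpha}(u,v)=\frac{e^{-s}}{1-e^{-2s}}\,(uv)^{-\alpha+1/2}\,I_{\alpha-1/2}\!\left(\frac{e^{-s}uv}{1-e^{-2s}}\right)\exp\!\left(-\frac14\,\frac{1+e^{-2s}}{1-e^{-2s}}\,(u^2+v^2)\right)$$ be the heat kernel of the Laguerre operator $-\frac{d^2}{du^2}-\frac{2\alpha}{u}\frac{d}{du}+\frac{u^2}{4}$ on $(0,\infty)$, where $I_\nu$ is the modified Bessel function of the first kind and order $\nu$. Let $r=(r_1,\dots,r_n)$, where each $r_j:[0,\infty)\to[0,\infty)$ is continuous and increasing (that is, non-decreasing), $r_j(0)=0$, $r_j(t)>0$ for every $t>0$, and $\lim_{t\to+\infty}r_j(t)=+\infty$. Then, for every $1\le p<\infty$ and every real- or complex-valued $f\in L^p((0,\infty)^n,d\mu_\lambda)$, the integral $$\mathbb{L}^{\lambda}_{r(t)}(f)(x)=\int_{(0,\infty)^n}\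 \prod_{j=1}^n L^{\lambda_j}_{r_j(t)}(x_j,y_j)\,f(y)\,d\mu_\lambda(y)$$ converges absolutely for all $t>0$ and $x\in(0,\infty)^n$, and $$\lim_{t\to0^+}\mathbb{L}^{\lambda}_{r(t)}(f)(x)=f(x)\qquad\text{for a.e. }x\in(0,\infty)^n.$$ -/

import Mathlib

open MeasureTheory Filter Topology
open scoped ENNReal Nat

noncomputable section

namespace LaguerreHeat

/-- The modified Bessel function of the first kind `I_ν(z)`, for real order `ν > -1` and `z > 0`,
by its everywhere convergent power series. -/
def besselI (ν z : ℝ) : ℝ :=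
  ∑' k : ℕ, (z / 2) ^ (2 * (k : ℝ) + ν) / ((k ! : ℝ) * Real.Gamma (k + ν + 1))

/-- The one-dimensional Laguerre heat kernel `L_t^lam(x, y)`, for `t, x, y > 0`. -/
def heatKernel (lam t x y : ℝ) : ℝ :=
  Real.exp (-t) / (1 - Real.exp (-2 * t)) * (x * y) ^ (-lam + 1 / 2) *
    besselI (lam - 1 / 2) (Real.exp (-t) * x * y / (1 - Real.exp (-2 * t))) *
    Real.exp (-(1 / 4) * ((1 + Real.exp (-2 * t)) / (1 - Real.exp (-2 * t))) * (x ^ 2 + y ^ 2))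

/-- The measure `x ^ (2 * lam) dx` on `(0, ∞)`, seen as a measure on `ℝ` that gives
no mass to the complement of `(0, ∞)`. -/
def measureOne (lam : ℝ) : Measure ℝ :=
  (volume.restrict (Set.Ioi 0)).withDensity fun x => ENNReal.ofReal (x ^ (2 * lam))

/-- The measure `dμ_lam(x) = ∏ j, x_j ^ (2 * lam_j) dx_j` on `(0, ∞)ⁿ`, seen as a measure on `ℝⁿ`
that gives no mass to the complement of `(0, ∞)ⁿ`. -/
def mu {n : ℕ} (lam : Fin n → ℝ) : Measure (Fin n → ℝ) :=
  Measure.pi fun j => measureOne (lam j)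

/-- The `n`-dimensional Laguerre heat kernel with one time parameter `s j` for each variable. -/
def heatKernelN {n : ℕ} (lam s x y : Fin n → ℝ) : ℝ :=
  ∏ j, heatKernel (lam j) (s j) (x j) (y j)

/-- The Laguerre heat operator with one time parameter `s j` for each variable. -/
def heatOp {𝕜 : Type*} [RCLike 𝕜] {n : ℕ} (lam s : Fin n → ℝ) (f : (Fin n → ℝ) → 𝕜)
    (x : Fin n → ℝ) : 𝕜 :=
  ∫ y, heatKernelN lam s x y • f y ∂(mu lam)

end LaguerreHeat

end

/-! Convergence is proved at points of continuity of bounded functions, transferred to `L¹` by a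
weak type (1,1) maximal inequality and density of continuous functions of compact support, and
extended by `L^p ⊂ L¹ + L^∞`. A bounded function is cut along a ball around the origin containing
`x`: the inner piece is integrable, the outer one vanishes near `x`.

Maximal inequality. Put `q = 1 / (2 sinh t)` and `ρ = q ^ (-1/2)`. The growth of the Bessel series
(`exists_besselSeries_le`) gives a one-dimensional Gaussian bound of width `ρ`. Split dyadically, it
dominates the product kernel by normalized indicators of boxes with half-widths `2 ^ k ρ_j`, with
weights `4 ^ (-k)` (`exists_heatKernelN_le`). Boxes with independent sides would not allow a weak
type (1,1) inequality in general. Here all sides increase with the single parameter `t`, so of two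
boxes one is the wider in every direction, and Vitali covering together with doubling suffices
(`exists_weak_type_boxes`).

Continuity points. Integrating the Bessel series termwise against a Gaussian gives the moments `∫ L
exp (θ (v² - u²))` in closed form; they tend to 1 as `t → 0` for every real `θ`
(`tendsto_integral_heatKernel_mul_exp`). The case `θ = 0` is the total mass, and large `±θ` force
concentration at `x` by an exponential Chebyshev inequality (`norm_sub_le_add_sum_exp`). -/

namespace LaguerreHeat

/-! ### Growth of the Bessel series. -/

/-- The coefficients of the entire function `z ^ (-(lam - 1 / 2)) I_{lam - 1 / 2}(z)`, up to a
power of two. -/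
noncomputable def besselCoeff (lam : ℝ) (k : ℕ) : ℝ :=
  ((4 : ℝ) ^ k * k ! * Real.Gamma (k + lam + 1 / 2))⁻¹

/-- The even entire function `(z / 2) ^ (-(lam - 1 / 2)) I_{lam - 1 / 2}(z)`. -/
noncomputable def besselSeries (lam z : ℝ) : ℝ := ∑' k, besselCoeff lam k * z ^ (2 * k)

theorem Gamma_add_natCast {s : ℝ} (hs : 0 < s) (n : ℕ) :
    Real.Gamma (s + n) = (∏ j ∈ Finset.range n, (s + j)) * Real.Gamma s := by
  induction n with
  | zero => simp
  | succ n ih =>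
    rw [Finset.prod_range_succ, Nat.cast_succ, ← add_assoc, Real.Gamma_add_one (by positivity), ih]
    ring

/-- Euler's sequence `Real.GammaSeq s` converges, hence is bounded, which bounds `k ^ s * k !` by a
multiple of `∏ j ≤ k, (s + j)`, that is, of `Γ (s + k + 1)`. -/
theorem exists_inv_Gamma_le {s : ℝ} (hs : 0 < s) :
    ∃ C : ℝ, 0 < C ∧ ∀ k : ℕ, (Real.Gamma (k + s))⁻¹ ≤ C * (k + 1 : ℝ) ^ (1 - s) / k ! := by
  obtain ⟨B, hB⟩ := (Real.GammaSeq_tendsto_Gamma s).bddAbove_range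
  have hB' : ∀ n, Real.GammaSeq s n ≤ B := fun n => hB ⟨n, rfl⟩
  have hG := Real.Gamma_pos_of_pos hs
  have hseq : ∀ n : ℕ, 0 < n → 0 < Real.GammaSeq s n := fun n hn => by
    unfold Real.GammaSeq
    have : 0 < ∏ j ∈ Finset.range (n + 1), (s + j) := Finset.prod_pos fun j _ => by positivity
    positivity
  have hB0 : 0 < B := (hseq 1 one_pos).trans_le (hB' 1)
  -- The second summand serves only `k = 0`, where Euler's sequence says nothing.
  refine ⟨B * (s + 1) * 2 ^ s / Real.Gamma s + (Real.Gamma s)⁻¹, by positivity, fun k => ?_⟩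
  rcases Nat.eq_zero_or_pos k with rfl | hk
  · simp only [Nat.cast_zero, zero_add, Real.one_rpow, Nat.factorial_zero, Nat.cast_one, mul_one,
      div_one]
    have : 0 ≤ B * (s + 1) * 2 ^ s / Real.Gamma s := by positivity
    linarith
  have hk' : (0 : ℝ) < k := by exact_mod_cast hk
  have hk1 : (1 : ℝ) ≤ k := by exact_mod_cast hk
  set P : ℝ := ∏ j ∈ Finset.range k, (s + j) with hP
  have hPpos : 0 < P := Finset.prod_pos fun j _ => by positivity
  have h1 : (k : ℝ) ^ s * k ! ≤ B * (P * (s + k)) := by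
    have := hB' k
    rw [Real.GammaSeq, Finset.prod_range_succ, div_le_iff₀ (by positivity)] at this
    exact this
  have h2 : ((k : ℝ) + 1) ^ s ≤ 2 ^ s * (k : ℝ) ^ s := by
    rw [← Real.mul_rpow (by norm_num) hk'.le]
    exact Real.rpow_le_rpow (by positivity) (by linarith) hs.le
  have h3 : s + k ≤ (s + 1) * (k + 1) := by nlinarith
  have h4 : ((k : ℝ) + 1) ^ s * k ! ≤ B * (s + 1) * 2 ^ s * P * (k + 1) := by
    calc ((k : ℝ) + 1) ^ s * k ! ≤ 2 ^ s * ((k : ℝ) ^ s * k !) := by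
          rw [← mul_assoc]; gcongr
      _ ≤ 2 ^ s * (B * (P * ((s + 1) * (k + 1)))) := by
          refine mul_le_mul_of_nonneg_left (h1.trans ?_) (by positivity)
          gcongr
      _ = _ := by ring
  rw [add_comm (k : ℝ) s, Gamma_add_natCast hs, ← hP, Real.rpow_sub (by positivity), Real.rpow_one,
    add_mul, add_div]
  have h5 : (P * Real.Gamma s)⁻¹ ≤
      B * (s + 1) * 2 ^ s / Real.Gamma s * ((k + 1) / (k + 1) ^ s) / k ! := by
    rw [inv_eq_one_div, div_le_iff₀ (by positivity)]
    have : B * (s + 1) * 2 ^ s / Real.Gamma s * ((k + 1) / (k + 1) ^ s) / k ! * (P * Real.Gamma s)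
      = (B * (s + 1) * 2 ^ s * P * (k + 1)) / (((k : ℝ) + 1) ^ s * k !) := by
      field_simp
    rw [this, le_div_iff₀ (by positivity), one_mul]
    exact h4
  have h6 : 0 ≤ (Real.Gamma s)⁻¹ * (((k : ℝ) + 1) / (k + 1) ^ s) / k ! := by positivity
  linarith

/-- The weight `2k + 1` makes the induction close, since `(2k + 1)(2k + 3) ≤ 4 (k + 1)²`. -/
theorem centralBinom_sq_mul_le (k : ℕ) : k.centralBinom ^ 2 * (2 * k + 1) ≤ 16 ^ k := by
  induction k with
  | zero => simp
  | succ k ih =>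
    have h := Nat.succ_mul_centralBinom_succ k
    have h2 : (k + 1) ^ 2 * ((k + 1).centralBinom ^ 2 * (2 * (k + 1) + 1)) ≤
        (k + 1) ^ 2 * 16 ^ (k + 1) := by
      calc (k + 1) ^ 2 * ((k + 1).centralBinom ^ 2 * (2 * (k + 1) + 1))
          = ((k + 1) * (k + 1).centralBinom) ^ 2 * (2 * k + 3) := by ring
        _ = k.centralBinom ^ 2 * (2 * k + 1) * (4 * ((2 * k + 1) * (2 * k + 3))) := by
            rw [h]; ring
        _ ≤ 16 ^ k * (4 * (4 * (k + 1) ^ 2)) := by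
            refine Nat.mul_le_mul ih (Nat.mul_le_mul le_rfl ?_)
            nlinarith
        _ = _ := by ring
    exact Nat.le_of_mul_le_mul_left h2 (by positivity)

theorem centralBinom_le_rpow (k : ℕ) :
    (k.centralBinom : ℝ) ≤ 4 ^ k * (k + 1 : ℝ) ^ (-(1 / 2) : ℝ) := by
  have h : (k.centralBinom : ℝ) ^ 2 * (2 * k + 1) ≤ 16 ^ k := by
    exact_mod_cast centralBinom_sq_mul_le k
  refine abs_le_of_sq_le_sq' ?_ (by positivity) |>.2
  rw [mul_pow, ← Real.rpow_natCast (((k : ℝ) + 1) ^ (-(1 / 2) : ℝ)), ← Real.rpow_mul (by positivity)]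
  norm_num
  rw [Real.rpow_neg_one, ← div_eq_mul_inv, le_div_iff₀ (by positivity), ← pow_mul, mul_comm k 2,
    pow_mul]
  norm_num
  refine le_trans ?_ h
  gcongr
  linarith [(Nat.cast_nonneg k : (0 : ℝ) ≤ k)]

theorem besselCoeff_pos {lam : ℝ} (hlam : -(1 / 2 : ℝ) < lam) (k : ℕ) : 0 < besselCoeff lam k := by
  have : 0 < Real.Gamma (k + lam + 1 / 2) := Real.Gamma_pos_of_pos (by
    have : (0 : ℝ) ≤ k := k.cast_nonneg
    linarith)
  unfold besselCoeff
  positivity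

/-- As `(2k)! = centralBinom k * (k !)²`, the Gamma and central binomial bounds combine, with
exponents `1/2 - lam` and `-1/2`. The Bessel series is thus compared with the even terms of the
exponential series. -/
theorem exists_besselCoeff_le {lam : ℝ} (hlam : -(1 / 2 : ℝ) < lam) :
    ∃ C : ℝ, 0 < C ∧ ∀ k : ℕ, besselCoeff lam k ≤ C * (k + 1 : ℝ) ^ (-lam) / (2 * k)! := by
  obtain ⟨C, hC, h⟩ := exists_inv_Gamma_le (s := lam + 1 / 2) (by linarith)
  refine ⟨C, hC, fun k => ?_⟩
  have h1 : ((2 * k)! : ℝ) = k.centralBinom * (k ! * k !) := by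
    have := Nat.choose_mul_factorial_mul_factorial (n := 2 * k) (k := k) (by omega)
    rw [show 2 * k - k = k by omega] at this
    rw [Nat.centralBinom, ← this]
    push_cast
    ring
  rw [le_div_iff₀ (by positivity), besselCoeff, mul_inv, add_assoc, h1]
  calc ((4 : ℝ) ^ k * k !)⁻¹ * (Real.Gamma (k + (lam + 1 / 2)))⁻¹ * (k.centralBinom * (k ! * k !))
      ≤ ((4 : ℝ) ^ k * k !)⁻¹ * (C * (k + 1 : ℝ) ^ (1 - (lam + 1 / 2)) / k !) *
        (4 ^ k * (k + 1 : ℝ) ^ (-(1 / 2) : ℝ) * (k ! * k !)) := by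
        gcongr
        · exact h k
        · exact centralBinom_le_rpow k
    _ = C * ((k + 1 : ℝ) ^ (1 - (lam + 1 / 2)) * (k + 1 : ℝ) ^ (-(1 / 2) : ℝ)) := by
        field_simp
    _ = C * (k + 1 : ℝ) ^ (-lam) := by
        rw [← Real.rpow_add (by positivity)]
        congr 2
        ring

/-- Trades a real exponent for the integer exponents `0`, `1`, `-N`, for which the exponential sums
below are elementary. -/
theorem rpow_neg_le_one_add {a τ : ℝ} {N : ℕ} (ha : -1 ≤ a) (haN : a ≤ N) (hτ : 0 < τ) :
    τ ^ (-a) ≤ 1 + τ + (τ ^ N)⁻¹ := by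
  have hN : 0 < (τ ^ N)⁻¹ := by positivity
  rcases le_total 1 τ with h | h
  · have : τ ^ (-a) ≤ τ ^ (1 : ℝ) := Real.rpow_le_rpow_of_exponent_le h (by linarith)
    rw [Real.rpow_one] at this
    linarith
  · have : τ ^ (-a) ≤ τ ^ (-(N : ℝ)) := Real.rpow_le_rpow_of_exponent_ge hτ h (by linarith)
    rw [Real.rpow_neg hτ.le (N : ℝ), Real.rpow_natCast] at this
    linarith

theorem hasSum_pow_div_factorial (z : ℝ) : HasSum (fun m : ℕ => z ^ m / m !) (Real.exp z) := by
  rw [Real.exp_eq_exp_ℝ]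
  exact NormedSpace.expSeries_div_hasSum_exp z

theorem hasSum_pow_div_factorial_mul_succ (z : ℝ) :
    HasSum (fun m : ℕ => z ^ m / m ! * (m + 1)) ((1 + z) * Real.exp z) := by
  have h := hasSum_pow_div_factorial z
  have h2 : HasSum (fun m : ℕ => z ^ m / m ! * m) (z * Real.exp z) := by
    rw [← hasSum_nat_add_iff' 1]
    simp only [Finset.range_one, Finset.sum_singleton, Nat.cast_zero, mul_zero, sub_zero]
    refine (h.mul_left z).congr_fun ?_
    intro m
    rw [Nat.factorial_succ]
    push_cast
    field_simp
    ring
  have := h.add h2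
  convert this using 1
  · ext m; ring
  · ring

theorem tsum_pow_div_factorial_add_le {z : ℝ} (hz : 0 ≤ z) (N : ℕ) :
    ∑' m : ℕ, z ^ (m + N) / (m + N)! ≤ Real.exp z := by
  have h := hasSum_pow_div_factorial z
  rw [← h.tsum_eq, ← h.summable.sum_add_tsum_nat_add N]
  have : 0 ≤ ∑ i ∈ Finset.range N, z ^ i / (i ! : ℝ) := Finset.sum_nonneg fun i _ => by positivity
  linarith

theorem factorial_add_le (m N : ℕ) : (m + N)! ≤ m ! * (m + 1) ^ N * N ! := by
  induction N with
  | zero => simp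
  | succ N ih =>
    rw [← add_assoc, Nat.factorial_succ, Nat.factorial_succ]
    calc (m + N + 1) * (m + N)! ≤ ((m + 1) * (N + 1)) * (m ! * (m + 1) ^ N * N !) :=
          Nat.mul_le_mul (by nlinarith) ih
      _ = _ := by ring

/-- A negative power of `m + 1` amounts to a shift of the index in the exponential series; this
handles `z ≥ 1`, while for `z ≤ 1` the extra factor is bounded. -/
theorem pow_div_factorial_mul_div_le {z : ℝ} (hz : 0 ≤ z) (m N : ℕ) :
    z ^ m / m ! * ((1 + z) ^ N / (m + 1 : ℝ) ^ N) ≤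
      2 ^ N * (z ^ m / m !) + 2 ^ N * N ! * (z ^ (m + N) / (m + N)!) := by
  have hm : (1 : ℝ) ≤ (m + 1 : ℝ) ^ N := one_le_pow₀ (by linarith [(m.cast_nonneg : (0 : ℝ) ≤ m)])
  rcases le_total z 1 with h | h
  · have h1 : (1 + z) ^ N / (m + 1 : ℝ) ^ N ≤ 2 ^ N := by
      rw [div_le_iff₀ (by positivity)]
      calc (1 + z) ^ N ≤ 2 ^ N := pow_le_pow_left₀ (by linarith) (by linarith) N
        _ ≤ 2 ^ N * (m + 1 : ℝ) ^ N := le_mul_of_one_le_right (by positivity) hm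
    have h2 : 0 ≤ 2 ^ N * N ! * (z ^ (m + N) / (m + N)!) := by positivity
    have h3 : z ^ m / m ! * ((1 + z) ^ N / (m + 1 : ℝ) ^ N) ≤ z ^ m / m ! * 2 ^ N := by gcongr
    linarith
  · have h1 : (1 + z) ^ N ≤ 2 ^ N * z ^ N := by
      rw [← mul_pow]
      exact pow_le_pow_left₀ (by linarith) (by linarith) N
    have h2 : ((m + N)! : ℝ) ≤ m ! * (m + 1 : ℝ) ^ N * N ! := by exact_mod_cast factorial_add_le m N
    have h3 : 0 ≤ 2 ^ N * (z ^ m / m !) := by positivity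
    have h4 : z ^ m / m ! * ((1 + z) ^ N / (m + 1 : ℝ) ^ N) ≤
        2 ^ N * N ! * (z ^ (m + N) / (m + N)!) := by
      calc z ^ m / m ! * ((1 + z) ^ N / (m + 1 : ℝ) ^ N)
          ≤ z ^ m / m ! * ((2 ^ N * z ^ N) / (m + 1 : ℝ) ^ N) := by gcongr
        _ = 2 ^ N * N ! * (z ^ (m + N) / (m ! * (m + 1 : ℝ) ^ N * N !)) := by
            rw [pow_add]; field_simp
        _ ≤ _ := by gcongr
    linarith

theorem rpow_neg_succ_le (lam : ℝ) (k : ℕ) :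
    (k + 1 : ℝ) ^ (-lam) ≤ (1 + 2 ^ lam) * ((2 * k : ℕ) + 1 : ℝ) ^ (-lam) := by
  have hk : (0 : ℝ) ≤ k := k.cast_nonneg
  push_cast
  have h0 : 0 < (2 * (k : ℝ) + 1) ^ (-lam) := by positivity
  have h1 : (0 : ℝ) < 2 ^ lam := by positivity
  rcases le_total 0 lam with h | h
  · have h2 : (2 * ((k : ℝ) + 1)) ^ (-lam) ≤ (2 * (k : ℝ) + 1) ^ (-lam) :=
      Real.rpow_le_rpow_of_nonpos (by positivity) (by linarith) (by linarith)
    rw [Real.mul_rpow (by norm_num) (by positivity), Real.rpow_neg (by norm_num),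
      inv_mul_le_iff₀ h1] at h2
    linarith
  · have h2 : ((k : ℝ) + 1) ^ (-lam) ≤ (2 * (k : ℝ) + 1) ^ (-lam) :=
      Real.rpow_le_rpow (by positivity) (by linarith) (by linarith)
    nlinarith

/-- The growth of the modified Bessel function, uniformly on `[0, ∞)`. -/
theorem exists_besselSeries_le {lam : ℝ} (hlam : -(1 / 2 : ℝ) < lam) :
    ∃ C : ℝ, 0 < C ∧ ∀ z : ℝ, 0 ≤ z → Summable (fun k => besselCoeff lam k * z ^ (2 * k)) ∧
      besselSeries lam z ≤ C * (1 + z) ^ (-lam) * Real.exp z := by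
  obtain ⟨C, hC, hcoeff⟩ := exists_besselCoeff_le hlam
  obtain ⟨N, hN⟩ := exists_nat_ge lam
  set D : ℝ := C * (1 + 2 ^ lam) with hD
  have hDpos : 0 < D := by positivity
  refine ⟨D * (2 + 2 ^ N + 2 ^ N * N !), by positivity, fun z hz => ?_⟩
  -- The terms `z ^ m / m !` concentrate at `m ≈ z`, so `(m + 1) ^ (-lam)` is written `(1 + z) ^
  -- (-lam) * τ ^ (-lam)` with `τ = (m + 1) / (1 + z)`. The three parts of `H` majorize the
  -- contributions of `1`, `τ` and `τ ^ (-N)`, and each sums to at most a multiple of `exp z`.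
  set H : ℕ → ℝ := fun m => z ^ m / m ! + z ^ m / m ! * (m + 1) * (1 + z)⁻¹ +
    (2 ^ N * (z ^ m / m !) + 2 ^ N * N ! * (z ^ (m + N) / (m + N)!)) with hH
  have hS : Summable fun m : ℕ => z ^ (m + N) / ((m + N)! : ℝ) :=
    (summable_nat_add_iff N).2 (hasSum_pow_div_factorial z).summable
  have hHsum : HasSum H (Real.exp z + (1 + z) * Real.exp z * (1 + z)⁻¹ +
      (2 ^ N * Real.exp z + 2 ^ N * N ! * ∑' m : ℕ, z ^ (m + N) / (m + N)!)) :=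
    ((hasSum_pow_div_factorial z).add ((hasSum_pow_div_factorial_mul_succ z).mul_right _)).add
      (((hasSum_pow_div_factorial z).mul_left _).add (hS.hasSum.mul_left _))
  have hH0 : ∀ m, 0 ≤ H m := fun m => by positivity
  have hHle : ∑' m, H m ≤ (2 + 2 ^ N + 2 ^ N * N !) * Real.exp z := by
    rw [hHsum.tsum_eq]
    have h1 := tsum_pow_div_factorial_add_le hz N
    have h2 : (1 + z) * Real.exp z * (1 + z)⁻¹ = Real.exp z := by field_simp
    have h3 : 2 ^ N * N ! * ∑' m : ℕ, z ^ (m + N) / (m + N)! ≤ 2 ^ N * N ! * Real.exp z := by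
      gcongr
    rw [h2]
    linarith
  have hinj : Function.Injective fun k : ℕ => 2 * k := fun a b h => by simpa using h
  have hle : ∀ k, besselCoeff lam k * z ^ (2 * k) ≤ D * (1 + z) ^ (-lam) * H (2 * k) := by
    intro k
    set m := 2 * k with hm
    set τ : ℝ := (m + 1) / (1 + z) with hτ
    have hτ0 : 0 < τ := by positivity
    have h1 : ((m : ℝ) + 1) ^ (-lam) = (1 + z) ^ (-lam) * τ ^ (-lam) := by
      rw [← Real.mul_rpow (by positivity) hτ0.le, hτ, mul_div_cancel₀ _ (by positivity)]
    have h2 := rpow_neg_le_one_add (by linarith) hN hτ0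
    have h3 := pow_div_factorial_mul_div_le hz m N
    calc besselCoeff lam k * z ^ m ≤ C * (k + 1 : ℝ) ^ (-lam) / m ! * z ^ m := by
          gcongr
          exact hcoeff k
      _ ≤ C * ((1 + 2 ^ lam) * (m + 1 : ℝ) ^ (-lam)) / m ! * z ^ m := by
          gcongr
          exact rpow_neg_succ_le lam k
      _ = D * (1 + z) ^ (-lam) * (z ^ m / m ! * τ ^ (-lam)) := by
          rw [h1, hD]; ring
      _ ≤ D * (1 + z) ^ (-lam) * (z ^ m / m ! * (1 + τ + (τ ^ N)⁻¹)) := by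
          gcongr
      _ = D * (1 + z) ^ (-lam) * (z ^ m / m ! + z ^ m / m ! * (m + 1) * (1 + z)⁻¹ +
            z ^ m / m ! * ((1 + z) ^ N / (m + 1 : ℝ) ^ N)) := by
          rw [hτ, div_pow, inv_div]; ring
      _ ≤ _ := by
          gcongr
          simp only [hH]
          linarith
  have hsummH : Summable fun k => D * (1 + z) ^ (-lam) * H (2 * k) :=
    (hHsum.summable.comp_injective hinj).mul_left _
  have hsumm : Summable fun k => besselCoeff lam k * z ^ (2 * k) :=
    Summable.of_nonneg_of_le
      (fun k => mul_nonneg (besselCoeff_pos hlam k).le (by positivity)) hle hsummH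
  refine ⟨hsumm, ?_⟩
  calc besselSeries lam z ≤ ∑' k, D * (1 + z) ^ (-lam) * H (2 * k) :=
        hsumm.tsum_le_tsum hle hsummH
    _ = D * (1 + z) ^ (-lam) * ∑' k, H (2 * k) := tsum_mul_left
    _ ≤ D * (1 + z) ^ (-lam) * ((2 + 2 ^ N + 2 ^ N * N !) * Real.exp z) := by
        gcongr
        exact (tsum_comp_le_tsum_of_inj hHsum.summable hH0 hinj).trans hHle
    _ = _ := by ring

/-! ### Gaussian upper bound for the one-dimensional kernel. -/

theorem besselI_eq {lam z : ℝ} (hz : 0 < z) :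
    besselI (lam - 1 / 2) z = (z / 2) ^ (lam - 1 / 2) * besselSeries lam z := by
  rw [besselI, besselSeries, ← tsum_mul_left]
  congr 1
  ext k
  have h : (z / 2) ^ (2 * (k : ℝ)) = z ^ (2 * k) / 4 ^ k := by
    rw [← Nat.cast_two, ← Nat.cast_mul, Real.rpow_natCast, div_pow, Nat.cast_ofNat, pow_mul 2]
    norm_num
  rw [Real.rpow_add (by positivity), h, besselCoeff, show (k : ℝ) + (lam - 1 / 2) + 1 =
    k + lam + 1 / 2 by ring, mul_inv, mul_inv]
  field_simp

/-- The factor `1 / (2 sinh t)` of the Laguerre heat kernel. -/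
noncomputable def heatScale (t : ℝ) : ℝ := Real.exp (-t) / (1 - Real.exp (-2 * t))

/-- The factor `coth t / 4` in the exponent of the Laguerre heat kernel. -/
noncomputable def heatRate (t : ℝ) : ℝ :=
  1 / 4 * ((1 + Real.exp (-2 * t)) / (1 - Real.exp (-2 * t)))

/-- The spatial width of the Laguerre heat kernel at time `t`. -/
noncomputable def heatWidth (t : ℝ) : ℝ := (√(heatScale t))⁻¹

/-- The quantity comparable to the `measureOne lam`-measure of the interval of centre `u` and
radius `R`. -/
noncomputable def vol (lam u R : ℝ) : ℝ := R * (u + R) ^ (2 * lam)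

theorem exp_neg_two_mul (t : ℝ) : Real.exp (-2 * t) = Real.exp (-t) ^ 2 := by
  rw [← Real.exp_nat_mul]
  congr 1
  push_cast
  ring

theorem one_sub_exp_pos {t : ℝ} (ht : 0 < t) : 0 < 1 - Real.exp (-2 * t) := by
  have : Real.exp (-2 * t) < 1 := Real.exp_zero ▸ Real.exp_lt_exp.2 (by linarith)
  linarith

theorem heatScale_pos {t : ℝ} (ht : 0 < t) : 0 < heatScale t :=
  div_pos (Real.exp_pos _) (one_sub_exp_pos ht)

theorem heatWidth_pos {t : ℝ} (ht : 0 < t) : 0 < heatWidth t :=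
  inv_pos.2 (Real.sqrt_pos.2 (heatScale_pos ht))

theorem heatScale_eq {t : ℝ} (ht : 0 < t) : heatScale t = (heatWidth t ^ 2)⁻¹ := by
  rw [heatWidth, inv_pow, inv_inv, Real.sq_sqrt (heatScale_pos ht).le]

theorem heatScale_anti {s t : ℝ} (hs : 0 < s) (hst : s ≤ t) : heatScale t ≤ heatScale s := by
  have h1 : Real.exp (-t) ≤ Real.exp (-s) := Real.exp_le_exp.2 (by linarith)
  have h2 : Real.exp (-2 * t) ≤ Real.exp (-2 * s) := Real.exp_le_exp.2 (by linarith)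
  exact div_le_div₀ (Real.exp_pos _).le h1 (one_sub_exp_pos hs) (by linarith)

theorem heatWidth_mono {s t : ℝ} (hs : 0 < s) (hst : s ≤ t) : heatWidth s ≤ heatWidth t :=
  inv_anti₀ (Real.sqrt_pos.2 (heatScale_pos (hs.trans_le hst)))
    (Real.sqrt_le_sqrt (heatScale_anti hs hst))

/-- This is `(1 - exp (-t))² ≥ 0`. It turns `exp (q u v)` times the Gaussian factor of the kernel
into at most `exp (-q (u - v)² / 2)`. -/
theorem half_heatScale_le_heatRate {t : ℝ} (ht : 0 < t) : heatScale t / 2 ≤ heatRate t := by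
  have h := one_sub_exp_pos ht
  rw [heatScale, heatRate, div_div, ← mul_div_assoc, div_le_div_iff₀ (by positivity) h,
    exp_neg_two_mul] at *
  nlinarith [mul_nonneg h.le (sq_nonneg (Real.exp (-t) - 1))]

/-- The power of `u v` in the kernel cancels the singular power in the Bessel function, leaving an
entire series. -/
theorem heatKernel_eq {lam t u v : ℝ} (ht : 0 < t) (hu : 0 < u) (hv : 0 < v) :
    heatKernel lam t u v = heatScale t ^ (lam + 1 / 2) * 2 ^ (1 / 2 - lam) *
      besselSeries lam (heatScale t * u * v) * Real.exp (-heatRate t * (u ^ 2 + v ^ 2)) := by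
  have hq := heatScale_pos ht
  have h1 : Real.exp (-t) * u * v / (1 - Real.exp (-2 * t)) = heatScale t * u * v := by
    rw [heatScale]; ring
  have h2 : -(1 / 4) * ((1 + Real.exp (-2 * t)) / (1 - Real.exp (-2 * t))) * (u ^ 2 + v ^ 2) =
      -heatRate t * (u ^ 2 + v ^ 2) := by
    rw [heatRate]; ring
  rw [heatKernel, h1, h2, besselI_eq (by positivity), ← heatScale]
  congr 1
  rw [← mul_assoc]
  congr 1
  rw [mul_assoc (heatScale t) u v, Real.div_rpow (by positivity) (by norm_num),
    Real.mul_rpow hq.le (by positivity), show -lam + 1 / 2 = -(lam - 1 / 2) by ring,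
    show (1 / 2 - lam : ℝ) = -(lam - 1 / 2) by ring, Real.rpow_neg (by positivity),
    Real.rpow_neg (by norm_num), show lam + 1 / 2 = (lam - 1 / 2) + 1 by ring,
    Real.rpow_add_one hq.ne']
  field_simp

theorem besselSeries_nonneg {lam z : ℝ} (hlam : -(1 / 2 : ℝ) < lam) : 0 ≤ besselSeries lam z :=
  tsum_nonneg fun k => mul_nonneg (besselCoeff_pos hlam k).le (by rw [pow_mul]; positivity)

theorem heatKernel_nonneg {lam t u v : ℝ} (hlam : -(1 / 2 : ℝ) < lam) (ht : 0 < t) (hu : 0 < u)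
    (hv : 0 < v) : 0 ≤ heatKernel lam t u v := by
  rw [heatKernel_eq ht hu hv]
  have := heatScale_pos ht
  have := besselSeries_nonneg (z := heatScale t * u * v) hlam
  positivity

/-- The Gaussian upper bound for the one-dimensional Laguerre heat kernel. -/
theorem exists_heatKernel_le_exp {lam : ℝ} (hlam : -(1 / 2 : ℝ) < lam) :
    ∃ C : ℝ, 0 < C ∧ ∀ t u v : ℝ, 0 < t → 0 < u → 0 < v →
      heatKernel lam t u v ≤ C / (heatWidth t * (heatWidth t ^ 2 + u * v) ^ lam) *
        Real.exp (-(((u - v) / heatWidth t) ^ 2 / 2)) := by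
  obtain ⟨C, hC, h⟩ := exists_besselSeries_le hlam
  refine ⟨2 ^ (1 / 2 - lam) * C, by positivity, fun t u v ht hu hv => ?_⟩
  have hq := heatScale_pos ht
  have hr := heatWidth_pos ht
  set ρ := heatWidth t with hρ
  have hqρ : heatScale t = (ρ ^ 2)⁻¹ := heatScale_eq ht
  have h1 := (h (heatScale t * u * v) (by positivity)).2
  have h2 : heatScale t ^ (lam + 1 / 2) * (1 + heatScale t * u * v) ^ (-lam) =
      1 / (ρ * (ρ ^ 2 + u * v) ^ lam) := by
    have h3 : 1 + heatScale t * u * v = heatScale t * (ρ ^ 2 + u * v) := by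
      rw [hqρ]; field_simp
    have h4 : heatScale t ^ (1 / 2 : ℝ) = ρ⁻¹ := by
      rw [← Real.sqrt_eq_rpow, hρ, heatWidth, inv_inv]
    rw [h3, Real.mul_rpow hq.le (by positivity), Real.rpow_add hq, h4, Real.rpow_neg hq.le,
      Real.rpow_neg (by positivity)]
    have : 0 < heatScale t ^ lam := by positivity
    field_simp
  have h5 : Real.exp (heatScale t * u * v) * Real.exp (-heatRate t * (u ^ 2 + v ^ 2)) ≤
      Real.exp (-(((u - v) / ρ) ^ 2 / 2)) := by
    rw [← Real.exp_add, Real.exp_le_exp]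
    have h6 : (((u - v) / ρ) ^ 2 / 2) = heatScale t / 2 * (u - v) ^ 2 := by
      rw [hqρ]; field_simp
    have := half_heatScale_le_heatRate ht
    rw [h6]
    nlinarith [sq_nonneg u, sq_nonneg v]
  rw [heatKernel_eq ht hu hv]
  calc heatScale t ^ (lam + 1 / 2) * 2 ^ (1 / 2 - lam) *
      besselSeries lam (heatScale t * u * v) * Real.exp (-heatRate t * (u ^ 2 + v ^ 2))
      ≤ heatScale t ^ (lam + 1 / 2) * 2 ^ (1 / 2 - lam) *
      (C * (1 + heatScale t * u * v) ^ (-lam) * Real.exp (heatScale t * u * v)) *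
        Real.exp (-heatRate t * (u ^ 2 + v ^ 2)) := by gcongr
    _ = 2 ^ (1 / 2 - lam) * C * (heatScale t ^ (lam + 1 / 2) * (1 + heatScale t * u * v) ^ (-lam)) *
        (Real.exp (heatScale t * u * v) * Real.exp (-heatRate t * (u ^ 2 + v ^ 2))) := by ring
    _ ≤ 2 ^ (1 / 2 - lam) * C * (heatScale t ^ (lam + 1 / 2) * (1 + heatScale t * u * v) ^ (-lam)) *
        Real.exp (-(((u - v) / ρ) ^ 2 / 2)) := by gcongr
    _ = _ := by rw [h2]; ring

/-- Comparability in both directions allows an exponent of either sign, as `lam` may be negative. -/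
theorem rpow_le_rpow_abs_mul {a b K : ℝ} (ha : 0 < a) (hb : 0 < b) (hK : 0 < K) (hab : a ≤ K * b)
    (hba : b ≤ K * a) (x : ℝ) : a ^ x ≤ K ^ |x| * b ^ x := by
  rcases le_total 0 x with h | h
  · rw [abs_of_nonneg h, ← Real.mul_rpow hK.le hb.le]
    exact Real.rpow_le_rpow ha.le hab h
  · rw [abs_of_nonpos h, Real.rpow_neg hK.le, ← Real.inv_rpow hK.le,
      ← Real.mul_rpow (by positivity) hb.le]
    refine Real.rpow_le_rpow_of_nonpos (by positivity) ?_ h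
    rw [inv_mul_le_iff₀ hK]
    exact hba

theorem vol_pos {lam u R : ℝ} (hu : 0 < u) (hR : 0 < R) : 0 < vol lam u R := by
  unfold vol; positivity

/-- For `|u - v| < R = 2 ^ k ρ`, the quantities `(u + R)²` and `ρ² + u v` agree up to `4 ^ (k + 1)`.
The resulting loss `M ^ k` is harmless against the Gaussian factor. -/
theorem exists_heatKernel_le_vol {lam : ℝ} (hlam : -(1 / 2 : ℝ) < lam) :
    ∃ C M : ℝ, 0 < C ∧ 1 ≤ M ∧ ∀ (t u v : ℝ) (k : ℕ), 0 < t → 0 < u → 0 < v →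
      |u - v| < 2 ^ k * heatWidth t → heatKernel lam t u v ≤
        C * M ^ k / vol lam u (2 ^ k * heatWidth t) *
          Real.exp (-(((u - v) / heatWidth t) ^ 2 / 2)) := by
  obtain ⟨C, hC, h⟩ := exists_heatKernel_le_exp hlam
  have h4 : (1 : ℝ) ≤ 4 ^ |lam| := Real.one_le_rpow (by norm_num) (abs_nonneg _)
  refine ⟨C * 4 ^ |lam|, 2 * 4 ^ |lam|, by positivity, by linarith, fun t u v k ht hu hv huv => ?_⟩
  have hr := heatWidth_pos ht
  refine (h t u v ht hu hv).trans ?_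
  set ρ := heatWidth t with hρ
  set R := 2 ^ k * ρ with hR
  have hRpos : 0 < R := by positivity
  have hV := vol_pos (lam := lam) hu hRpos
  rw [abs_lt] at huv
  have h2k : (1 : ℝ) ≤ 2 ^ k := one_le_pow₀ (by norm_num)
  have hρR : ρ ≤ R := le_mul_of_one_le_left hr.le h2k
  have hR2 : R ^ 2 = 4 ^ k * ρ ^ 2 := by
    rw [hR, mul_pow, ← pow_mul, mul_comm k 2, pow_mul]; norm_num
  have h4k : (1 : ℝ) ≤ 4 ^ k := one_le_pow₀ (by norm_num)
  have hle1 : (u + R) ^ 2 ≤ 4 ^ (k + 1) * (ρ ^ 2 + u * v) := by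
    -- From `v > u - R`, the difference of the two sides is at least `3 (u - R)²`.
    have : (u + R) ^ 2 ≤ 4 * (u * v) + 4 * R ^ 2 := by nlinarith [sq_nonneg (u - R)]
    have h5 : 4 * (u * v) ≤ 4 * (4 ^ k * (u * v)) := by
      have := le_mul_of_one_le_left (mul_pos hu hv).le h4k
      linarith
    calc (u + R) ^ 2 ≤ 4 * (u * v) + 4 * R ^ 2 := this
      _ ≤ 4 * (4 ^ k * (u * v)) + 4 * (4 ^ k * ρ ^ 2) := by rw [← hR2]; linarith
      _ = _ := by ring
  have hle2 : ρ ^ 2 + u * v ≤ 4 ^ (k + 1) * (u + R) ^ 2 := by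
    have h5 : ρ ^ 2 + u * v ≤ (u + R) ^ 2 := by nlinarith
    have h6 : (1 : ℝ) ≤ 4 ^ (k + 1) := one_le_pow₀ (by norm_num)
    exact h5.trans (le_mul_of_one_le_left (by positivity) h6)
  have h5 := rpow_le_rpow_abs_mul (by positivity) (by positivity) (by positivity) hle1 hle2 lam
  have h6 : ((u + R) ^ 2) ^ lam = (u + R) ^ (2 * lam) := by
    rw [← Real.rpow_natCast, ← Real.rpow_mul (by positivity)]; norm_num
  have h7 : ((4 : ℝ) ^ (k + 1)) ^ |lam| = (4 ^ |lam|) ^ k * 4 ^ |lam| := by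
    rw [← pow_succ, ← Real.rpow_natCast, ← Real.rpow_mul (by norm_num), mul_comm,
      Real.rpow_mul (by norm_num), Real.rpow_natCast]
  rw [h6, h7] at h5
  have hV' : vol lam u R ≤ 4 ^ |lam| * (2 * 4 ^ |lam|) ^ k * (ρ * (ρ ^ 2 + u * v) ^ lam) := by
    calc vol lam u R ≤ 2 ^ k * ρ * ((4 ^ |lam|) ^ k * 4 ^ |lam| * (ρ ^ 2 + u * v) ^ lam) := by
          unfold vol; rw [← hR]; gcongr
      _ = _ := by rw [mul_pow]; ring
  refine mul_le_mul_of_nonneg_right ?_ (Real.exp_pos _).le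
  rw [div_le_div_iff₀ (by positivity) hV]
  calc C * vol lam u R ≤ C * (4 ^ |lam| * (2 * 4 ^ |lam|) ^ k * (ρ * (ρ ^ 2 + u * v) ^ lam)) := by
        gcongr
    _ = _ := by ring

/-! ### Doubling for the one-dimensional measure. -/

theorem measureOne_apply {lam : ℝ} {S : Set ℝ} (hS : MeasurableSet S) :
    measureOne lam S = ∫⁻ x in S ∩ Set.Ioi 0, ENNReal.ofReal (x ^ (2 * lam)) := by
  rw [measureOne, withDensity_apply _ hS, Measure.restrict_restrict hS]

theorem measureOne_Iio {lam b : ℝ} (hlam : -(1 / 2 : ℝ) < lam) (hb : 0 < b) :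
    measureOne lam (Set.Iio b) = ENNReal.ofReal (b ^ (2 * lam + 1) / (2 * lam + 1)) := by
  have hint : IntervalIntegrable (fun x : ℝ => x ^ (2 * lam)) volume 0 b :=
    intervalIntegral.intervalIntegrable_rpow' (by linarith)
  rw [measureOne_apply measurableSet_Iio, Set.inter_comm, Set.Ioi_inter_Iio,
    restrict_Ioo_eq_restrict_Ioc, ← ofReal_integral_eq_lintegral_ofReal
    ((intervalIntegrable_iff_integrableOn_Ioc_of_le hb.le).1 hint),
    ← intervalIntegral.integral_of_le hb.le, integral_rpow (Or.inl (by linarith)),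
    Real.zero_rpow (by linarith), sub_zero]
  filter_upwards [ae_restrict_mem measurableSet_Ioc] with x hx
  exact Real.rpow_nonneg hx.1.le _

/-- The doubling property of `measureOne lam`. -/
theorem exists_measureOne_Ioo_le {lam : ℝ} (hlam : -(1 / 2 : ℝ) < lam) :
    ∃ C : ℝ, 0 < C ∧ ∀ u R : ℝ, 0 < u → 0 < R →
      measureOne lam (Set.Ioo (u - 3 * R) (u + 3 * R)) ≤ ENNReal.ofReal (C * vol lam u R) := by
  have hl : 0 < 2 * lam + 1 := by linarith
  refine ⟨3 ^ |2 * lam| * (9 / (2 * lam + 1)) + 3 ^ |2 * lam| * 6, by positivity,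
    fun u R hu hR => ?_⟩
  have hV := vol_pos (lam := lam) hu hR
  -- Near the origin the density may be singular or degenerate, and only the total mass up to `u +
  -- 3R` is used. For `u ≥ 6R` every point of the interval is comparable to `u + R` up to a factor
  -- 3, and so the density is nearly constant.
  rcases le_total u (6 * R) with h | h
  · refine (measure_mono Set.Ioo_subset_Iio_self).trans ?_
    rw [measureOne_Iio hlam (by positivity)]
    refine ENNReal.ofReal_le_ofReal ?_
    have h1 := rpow_le_rpow_abs_mul (a := u + 3 * R) (b := u + R) (K := 3) (by positivity)
      (by positivity) (by norm_num) (by linarith) (by linarith) (2 * lam)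
    rw [Real.rpow_add_one (by positivity)]
    calc (u + 3 * R) ^ (2 * lam) * (u + 3 * R) / (2 * lam + 1)
        ≤ (3 ^ |2 * lam| * (u + R) ^ (2 * lam)) * (9 * R) / (2 * lam + 1) := by
          gcongr
          linarith
      _ = 3 ^ |2 * lam| * (9 / (2 * lam + 1)) * vol lam u R := by
          unfold vol; ring
      _ ≤ _ := by
          gcongr
          have : (0 : ℝ) < 3 ^ |2 * lam| := by positivity
          linarith
  · rw [measureOne_apply measurableSet_Ioo]
    calc ∫⁻ x in Set.Ioo (u - 3 * R) (u + 3 * R) ∩ Set.Ioi 0, ENNReal.ofReal (x ^ (2 * lam))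
        ≤ ∫⁻ x in Set.Ioo (u - 3 * R) (u + 3 * R) ∩ Set.Ioi 0,
            ENNReal.ofReal (3 ^ |2 * lam| * (u + R) ^ (2 * lam)) := by
          refine setLIntegral_mono (by fun_prop) fun x hx => ENNReal.ofReal_le_ofReal ?_
          obtain ⟨⟨hx1, hx2⟩, hx0 : 0 < x⟩ := hx
          exact rpow_le_rpow_abs_mul hx0 (by positivity) (by norm_num) (by linarith)
            (by linarith) _
      _ ≤ ENNReal.ofReal (3 ^ |2 * lam| * (u + R) ^ (2 * lam)) * ENNReal.ofReal (6 * R) := by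
          rw [setLIntegral_const]
          gcongr
          refine (measure_mono Set.inter_subset_left).trans ?_
          rw [Real.volume_Ioo]
          exact ENNReal.ofReal_le_ofReal (by linarith)
      _ = ENNReal.ofReal (3 ^ |2 * lam| * 6 * vol lam u R) := by
          rw [← ENNReal.ofReal_mul (by positivity), vol]
          congr 1
          ring
      _ ≤ _ := by
          refine ENNReal.ofReal_le_ofReal ?_
          gcongr
          have : (0 : ℝ) < 3 ^ |2 * lam| * (9 / (2 * lam + 1)) := by positivity
          linarith

/-! ### Exponential moments of the one-dimensional kernel. -/

theorem ae_measureOne_pos (lam : ℝ) : ∀ᵐ x ∂measureOne lam, 0 < x :=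
  (withDensity_absolutelyContinuous _ _).ae_le (ae_restrict_mem measurableSet_Ioi)

theorem integrable_measureOne_iff {lam : ℝ} {g : ℝ → ℝ} :
    Integrable g (measureOne lam) ↔
      IntegrableOn (fun x => x ^ (2 * lam) * g x) (Set.Ioi 0) := by
  rw [measureOne, integrable_withDensity_iff_integrable_smul₀' (by fun_prop) (by simp)]
  refine integrable_congr ?_
  filter_upwards [ae_restrict_mem measurableSet_Ioi] with x hx
  rw [ENNReal.toReal_ofReal (Real.rpow_nonneg (le_of_lt hx) _), smul_eq_mul]

theorem integral_measureOne {lam : ℝ} (g : ℝ → ℝ) :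
    ∫ x, g x ∂measureOne lam = ∫ x in Set.Ioi 0, x ^ (2 * lam) * g x := by
  rw [measureOne, integral_withDensity_eq_integral_toReal_smul₀ (by fun_prop) (by simp)]
  refine integral_congr_ae ?_
  filter_upwards [ae_restrict_mem measurableSet_Ioi] with x hx
  rw [ENNReal.toReal_ofReal (Real.rpow_nonneg (le_of_lt hx) _), smul_eq_mul]

theorem rpow_mul_pow_mul_exp {lam B x : ℝ} (hx : 0 < x) (k : ℕ) :
    x ^ (2 * lam) * (x ^ (2 * k) * Real.exp (-B * x ^ 2)) =
      x ^ (2 * lam + 2 * k) * Real.exp (-B * x ^ (2 : ℝ)) := by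
  rw [Real.rpow_add hx, ← Real.rpow_natCast x (2 * k), ← mul_assoc]
  norm_num

theorem integrable_pow_mul_exp {lam B : ℝ} (hlam : -(1 / 2 : ℝ) < lam) (hB : 0 < B) (k : ℕ) :
    Integrable (fun x => x ^ (2 * k) * Real.exp (-B * x ^ 2)) (measureOne lam) := by
  have hk : (0 : ℝ) ≤ k := k.cast_nonneg
  rw [integrable_measureOne_iff]
  refine (integrableOn_rpow_mul_exp_neg_mul_rpow (p := 2) (s := 2 * lam + 2 * k) (by linarith)
    (by norm_num) hB).congr_fun (fun x hx => (rpow_mul_pow_mul_exp hx k).symm) measurableSet_Ioi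

theorem integral_pow_mul_exp {lam B : ℝ} (hlam : -(1 / 2 : ℝ) < lam) (hB : 0 < B) (k : ℕ) :
    ∫ x, x ^ (2 * k) * Real.exp (-B * x ^ 2) ∂measureOne lam =
      (2 * B ^ (lam + 1 / 2))⁻¹ * (Real.Gamma (k + lam + 1 / 2) / B ^ k) := by
  have hk : (0 : ℝ) ≤ k := k.cast_nonneg
  rw [integral_measureOne, setIntegral_congr_fun measurableSet_Ioi
    (fun x hx => rpow_mul_pow_mul_exp hx k), integral_rpow_mul_exp_neg_mul_rpow (by norm_num)
    (by linarith) hB, show (2 * lam + 2 * k + 1) / 2 = k + lam + 1 / 2 by ring,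
    show -(2 * lam + 2 * k + 1) / 2 = -((lam + 1 / 2) + k) by ring, Real.rpow_neg hB.le,
    Real.rpow_add hB, Real.rpow_natCast]
  have : 0 < B ^ (lam + 1 / 2) := by positivity
  field_simp

/-- The Gaussian integral of the Bessel series. -/
theorem integral_besselSeries_mul_exp {lam B a : ℝ} (hlam : -(1 / 2 : ℝ) < lam) (hB : 0 < B) :
    ∫ v, besselSeries lam (a * v) * Real.exp (-B * v ^ 2) ∂measureOne lam =
      (2 * B ^ (lam + 1 / 2))⁻¹ * Real.exp (a ^ 2 / (4 * B)) := by
  set F : ℕ → ℝ → ℝ := fun k v =>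
    besselCoeff lam k * a ^ (2 * k) * (v ^ (2 * k) * Real.exp (-B * v ^ 2)) with hF
  have hval : ∀ k, ∫ v, F k v ∂measureOne lam =
      (2 * B ^ (lam + 1 / 2))⁻¹ * ((a ^ 2 / (4 * B)) ^ k / k !) := by
    intro k
    have hG : 0 < Real.Gamma (k + lam + 1 / 2) := Real.Gamma_pos_of_pos (by
      have : (0 : ℝ) ≤ k := k.cast_nonneg
      linarith)
    -- The Gamma value of the Gaussian moment cancels the one in `besselCoeff`, leaving an
    -- exponential series.
    rw [hF, integral_const_mul, integral_pow_mul_exp hlam hB, besselCoeff, div_pow, mul_pow, pow_mul]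
    generalize Real.Gamma (k + lam + 1 / 2) = G at *
    have : 0 < B ^ (lam + 1 / 2) := by positivity
    field_simp
  have hnonneg : ∀ k v, 0 ≤ F k v := fun k v => by
    have := (besselCoeff_pos hlam k).le
    simp only [hF, pow_mul]
    positivity
  have hsum : HasSum (fun k : ℕ => (2 * B ^ (lam + 1 / 2))⁻¹ * ((a ^ 2 / (4 * B)) ^ k / k !))
      ((2 * B ^ (lam + 1 / 2))⁻¹ * Real.exp (a ^ 2 / (4 * B))) :=
    (hasSum_pow_div_factorial _).mul_left _
  have h := hasSum_integral_of_summable_integral_norm (F := F) (μ := measureOne lam)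
    (fun k => (integrable_pow_mul_exp hlam hB k).const_mul _) (by
      simp only [Real.norm_of_nonneg (hnonneg _ _), hval]
      exact hsum.summable)
  simp only [hval] at h
  rw [← h.unique hsum]
  congr 1
  ext v
  rw [besselSeries, ← tsum_mul_right]
  congr 1
  ext k
  simp only [hF]
  ring

/-- The identity `coth² - 1 = 1 / sinh²`. It makes the exponent in the moments collapse to a
multiple of `4 θ² - 1/4`. -/
theorem four_mul_heatRate_sq {t : ℝ} (ht : 0 < t) :
    heatScale t ^ 2 = 4 * heatRate t ^ 2 - 1 / 4 := by
  have h := one_sub_exp_pos ht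
  rw [heatScale, heatRate, exp_neg_two_mul] at *
  field_simp
  ring

/-- The exponential moments of the one-dimensional Laguerre heat kernel. -/
theorem integral_heatKernel_mul_exp {lam t u θ : ℝ} (hlam : -(1 / 2 : ℝ) < lam) (ht : 0 < t)
    (hu : 0 < u) (hθ : θ < heatRate t) :
    ∫ v, heatKernel lam t u v * Real.exp (θ * (v ^ 2 - u ^ 2)) ∂measureOne lam =
      (heatScale t / (2 * (heatRate t - θ))) ^ (lam + 1 / 2) *
        Real.exp (u ^ 2 * (4 * θ ^ 2 - 1 / 4) / (4 * (heatRate t - θ))) := by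
  have hq := heatScale_pos ht
  have hB : 0 < heatRate t - θ := by linarith
  set K : ℝ := heatScale t ^ (lam + 1 / 2) * 2 ^ (1 / 2 - lam) *
    Real.exp (-(heatRate t + θ) * u ^ 2) with hK
  have h1 : ∀ᵐ v ∂measureOne lam, heatKernel lam t u v * Real.exp (θ * (v ^ 2 - u ^ 2)) =
      K * (besselSeries lam ((heatScale t * u) * v) * Real.exp (-(heatRate t - θ) * v ^ 2)) := by
    filter_upwards [ae_measureOne_pos lam] with v hv
    rw [heatKernel_eq ht hu hv, hK]
    have : Real.exp (-heatRate t * (u ^ 2 + v ^ 2)) * Real.exp (θ * (v ^ 2 - u ^ 2)) =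
        Real.exp (-(heatRate t + θ) * u ^ 2) * Real.exp (-(heatRate t - θ) * v ^ 2) := by
      rw [← Real.exp_add, ← Real.exp_add]
      congr 1
      ring
    rw [mul_assoc, this]
    ring
  rw [integral_congr_ae h1, integral_const_mul, integral_besselSeries_mul_exp hlam hB, hK]
  have h2 : Real.exp (-(heatRate t + θ) * u ^ 2) *
      Real.exp ((heatScale t * u) ^ 2 / (4 * (heatRate t - θ))) =
      Real.exp (u ^ 2 * (4 * θ ^ 2 - 1 / 4) / (4 * (heatRate t - θ))) := by
    rw [← Real.exp_add, mul_pow, four_mul_heatRate_sq ht]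
    congr 1
    field_simp
    ring
  rw [← h2, Real.div_rpow hq.le (by positivity), Real.mul_rpow (by norm_num) hB.le,
    show (1 / 2 - lam : ℝ) = 1 - (lam + 1 / 2) by ring, Real.rpow_sub (by norm_num), Real.rpow_one]
  have : 0 < (heatRate t - θ) ^ (lam + 1 / 2) := by positivity
  have : (0 : ℝ) < 2 ^ (lam + 1 / 2) := by positivity
  field_simp

/-- The Bochner integral of a non-integrable function is 0 by convention, whereas the closed form is
positive. -/
theorem integrable_heatKernel_mul_exp {lam t u θ : ℝ} (hlam : -(1 / 2 : ℝ) < lam) (ht : 0 < t)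
    (hu : 0 < u) (hθ : θ < heatRate t) :
    Integrable (fun v => heatKernel lam t u v * Real.exp (θ * (v ^ 2 - u ^ 2)))
      (measureOne lam) := by
  by_contra h
  have h1 := integral_heatKernel_mul_exp hlam ht hu hθ
  rw [integral_undef h] at h1
  have hq := heatScale_pos ht
  have hB : 0 < heatRate t - θ := by linarith
  have : 0 < (heatScale t / (2 * (heatRate t - θ))) ^ (lam + 1 / 2) *
      Real.exp (u ^ 2 * (4 * θ ^ 2 - 1 / 4) / (4 * (heatRate t - θ))) := by positivity
  exact this.ne h1

theorem eventually_lt_heatRate (θ : ℝ) : ∀ᶠ t in 𝓝[>] (0 : ℝ), θ < heatRate t := by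
  have h1 : Tendsto (fun t : ℝ => (1 + Real.exp (-2 * t)) - 4 * θ * (1 - Real.exp (-2 * t)))
      (𝓝[>] 0) (𝓝 2) := by
    have : Continuous fun t : ℝ =>
      (1 + Real.exp (-2 * t)) - 4 * θ * (1 - Real.exp (-2 * t)) := by fun_prop
    have h := (this.tendsto 0).mono_left (nhdsWithin_le_nhds (s := Set.Ioi 0))
    convert h using 2
    norm_num
  filter_upwards [h1.eventually (lt_mem_nhds (show (0 : ℝ) < 2 by norm_num)),
    self_mem_nhdsWithin] with t ht ht0
  have h := one_sub_exp_pos ht0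
  rw [heatRate, ← mul_div_assoc, lt_div_iff₀ h]
  linarith

theorem tendsto_integral_heatKernel_mul_exp {lam : ℝ} (hlam : -(1 / 2 : ℝ) < lam) {u : ℝ}
    (hu : 0 < u) (θ : ℝ) :
    Tendsto (fun t => ∫ v, heatKernel lam t u v * Real.exp (θ * (v ^ 2 - u ^ 2)) ∂measureOne lam)
      (𝓝[>] 0) (𝓝 1) := by
  have hden : Tendsto (fun t : ℝ => (1 + Real.exp (-2 * t)) - 4 * θ * (1 - Real.exp (-2 * t)))
      (𝓝[>] 0) (𝓝 2) := by
    have : Continuous fun t : ℝ =>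
      (1 + Real.exp (-2 * t)) - 4 * θ * (1 - Real.exp (-2 * t)) := by fun_prop
    have h := (this.tendsto 0).mono_left (nhdsWithin_le_nhds (s := Set.Ioi 0))
    convert h using 2
    norm_num
  have hexp : Tendsto (fun t : ℝ => 2 * Real.exp (-t)) (𝓝[>] 0) (𝓝 2) := by
    have : Continuous fun t : ℝ => 2 * Real.exp (-t) := by fun_prop
    have h := (this.tendsto 0).mono_left (nhdsWithin_le_nhds (s := Set.Ioi 0))
    convert h using 2
    norm_num
  have hnum : Tendsto (fun t : ℝ => u ^ 2 * (4 * θ ^ 2 - 1 / 4) * (1 - Real.exp (-2 * t)))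
      (𝓝[>] 0) (𝓝 0) := by
    have : Continuous fun t : ℝ => u ^ 2 * (4 * θ ^ 2 - 1 / 4) * (1 - Real.exp (-2 * t)) := by
      fun_prop
    have h := (this.tendsto 0).mono_left (nhdsWithin_le_nhds (s := Set.Ioi 0))
    convert h using 2
    norm_num
  have h1 := ((hexp.div hden (by norm_num)).rpow_const (p := lam + 1 / 2) (Or.inl (by norm_num))).mul
    ((Real.continuous_exp.tendsto _).comp (hnum.div hden (by norm_num)))
  have h2 : ((2 : ℝ) / 2) ^ (lam + 1 / 2) * Real.exp (0 / 2) = 1 := by norm_num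
  rw [h2] at h1
  refine h1.congr' ?_
  filter_upwards [eventually_lt_heatRate θ, self_mem_nhdsWithin] with t hθ ht
  rw [integral_heatKernel_mul_exp hlam ht hu hθ]
  have h := one_sub_exp_pos ht
  -- Clearing the denominator `1 - exp (-2t)` exhibits the moment through functions continuous at `t
  -- = 0`.
  have h3 : 4 * (heatRate t - θ) = ((1 + Real.exp (-2 * t)) - 4 * θ * (1 - Real.exp (-2 * t))) /
      (1 - Real.exp (-2 * t)) := by
    rw [heatRate]
    generalize Real.exp (-2 * t) = e at *
    field_simp
  have h4 : heatScale t / (2 * (heatRate t - θ)) = 2 * heatScale t / (4 * (heatRate t - θ)) := by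
    rw [show 4 * (heatRate t - θ) = 2 * (2 * (heatRate t - θ)) by ring,
      mul_div_mul_left _ _ (by norm_num)]
  have h5 : 0 < (1 + Real.exp (-2 * t)) - 4 * θ * (1 - Real.exp (-2 * t)) := by
    have : 0 < 4 * (heatRate t - θ) := by linarith
    rw [h3] at this
    exact (div_pos_iff_of_pos_right h).1 this
  rw [h4, h3, heatScale]
  simp only [Pi.div_apply, Function.comp_apply]
  generalize Real.exp (-2 * t) = e at *
  congr 2
  · field_simp
  · field_simp

/-! ### The product kernel and convergence at points of continuity. -/

instance (lam : ℝ) : SigmaFinite (measureOne lam) := by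
  unfold measureOne; infer_instance

theorem isLocallyFiniteMeasure_measureOne {lam : ℝ} (hlam : -(1 / 2 : ℝ) < lam) :
    IsLocallyFiniteMeasure (measureOne lam) := by
  refine ⟨fun x => ⟨Set.Iio (|x| + 1), Iio_mem_nhds (by linarith [le_abs_self x]), ?_⟩⟩
  rw [measureOne_Iio hlam (by positivity)]
  exact ENNReal.ofReal_lt_top

variable {n : ℕ}

instance (lam : Fin n → ℝ) : SigmaFinite (mu lam) := by
  unfold mu; infer_instance

theorem isLocallyFiniteMeasure_mu {lam : Fin n → ℝ} (hlam : ∀ j, -(1 / 2 : ℝ) < lam j) :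
    IsLocallyFiniteMeasure (mu lam) := by
  have := fun j => isLocallyFiniteMeasure_measureOne (hlam j)
  unfold mu; infer_instance

theorem ae_mu_pos (lam : Fin n → ℝ) : ∀ᵐ x ∂mu lam, ∀ j, 0 < x j :=
  ae_all_iff.2 fun j => Measure.tendsto_eval_ae_ae.eventually (ae_measureOne_pos (lam j))

theorem heatKernelN_nonneg {lam s x y : Fin n → ℝ} (hlam : ∀ j, -(1 / 2 : ℝ) < lam j)
    (hs : ∀ j, 0 < s j) (hx : ∀ j, 0 < x j) (hy : ∀ j, 0 < y j) : 0 ≤ heatKernelN lam s x y :=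
  Finset.prod_nonneg fun j _ => heatKernel_nonneg (hlam j) (hs j) (hx j) (hy j)

theorem integrable_heatKernelN_mul_exp {lam s x θ : Fin n → ℝ} (hlam : ∀ j, -(1 / 2 : ℝ) < lam j)
    (hs : ∀ j, 0 < s j) (hx : ∀ j, 0 < x j) (hθ : ∀ j, θ j < heatRate (s j)) :
    Integrable (fun y => heatKernelN lam s x y * ∏ j, Real.exp (θ j * (y j ^ 2 - x j ^ 2)))
      (mu lam) := by
  simp only [heatKernelN, ← Finset.prod_mul_distrib]
  exact Integrable.fintype_prod fun j => integrable_heatKernel_mul_exp (hlam j) (hs j) (hx j) (hθ j)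

theorem tendsto_integral_heatKernelN_mul_exp {ι : Type*} {l : Filter ι} {lam x θ : Fin n → ℝ}
    {s : ι → Fin n → ℝ} (hlam : ∀ j, -(1 / 2 : ℝ) < lam j)
    (hs : ∀ j, Tendsto (fun i => s i j) l (𝓝[>] 0)) (hx : ∀ j, 0 < x j) :
    Tendsto (fun i => ∫ y, heatKernelN lam (s i) x y *
      ∏ j, Real.exp (θ j * (y j ^ 2 - x j ^ 2)) ∂mu lam) l (𝓝 1) := by
  have h : ∀ i, ∫ y, heatKernelN lam (s i) x y *
      ∏ j, Real.exp (θ j * (y j ^ 2 - x j ^ 2)) ∂mu lam = ∏ j, ∫ v, heatKernel (lam j) (s i j) (x j) v *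
        Real.exp (θ j * (v ^ 2 - x j ^ 2)) ∂measureOne (lam j) := fun i => by
    simp only [heatKernelN, ← Finset.prod_mul_distrib, mu]
    exact integral_fintype_prod_eq_prod
      (fun j v => heatKernel (lam j) (s i j) (x j) v * Real.exp (θ j * (v ^ 2 - x j ^ 2)))
  simp only [h]
  rw [← Finset.prod_const_one (ι := Fin n) (s := Finset.univ)]
  exact tendsto_finsetProd _ fun j _ =>
    (tendsto_integral_heatKernel_mul_exp (hlam j) (hx j) (θ j)).comp (hs j)

theorem prod_exp_single (x y : Fin n → ℝ) (j : Fin n) (θ : ℝ) :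
    ∏ i, Real.exp ((Pi.single j θ : Fin n → ℝ) i * (y i ^ 2 - x i ^ 2)) =
      Real.exp (θ * (y j ^ 2 - x j ^ 2)) := by
  rw [Finset.prod_eq_single j]
  · simp
  · intro i _ hi
    simp [hi]
  · simp

theorem integrable_heatKernelN {lam s x : Fin n → ℝ} (hlam : ∀ j, -(1 / 2 : ℝ) < lam j)
    (hs : ∀ j, 0 < s j) (hx : ∀ j, 0 < x j) : Integrable (heatKernelN lam s x) (mu lam) := by
  have := integrable_heatKernelN_mul_exp (θ := 0) hlam hs hx fun j =>
    (half_pos (heatScale_pos (hs j))).trans_le (half_heatScale_le_heatRate (hs j))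
  simpa using this

variable {𝕜 : Type*} [RCLike 𝕜]

theorem integrable_heatKernelN_smul_of_bound {lam s x : Fin n → ℝ}
    (hlam : ∀ j, -(1 / 2 : ℝ) < lam j) (hs : ∀ j, 0 < s j) (hx : ∀ j, 0 < x j)
    {f : (Fin n → ℝ) → 𝕜} (hf : AEStronglyMeasurable f (mu lam)) {M : ℝ} (hM : ∀ y, ‖f y‖ ≤ M) :
    Integrable (fun y => heatKernelN lam s x y • f y) (mu lam) := by
  have hK := integrable_heatKernelN hlam hs hx
  refine (hK.mul_const M).mono' (hK.aestronglyMeasurable.smul hf) ?_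
  filter_upwards [ae_mu_pos lam] with y hy
  have h0 := heatKernelN_nonneg hlam hs hx hy
  rw [norm_smul, Real.norm_of_nonneg h0]
  exact mul_le_mul_of_nonneg_left (hM y) h0

/-- A bound, by exponential moments, for the increments of a bounded function that is nearly
constant close to `x`. -/
theorem norm_sub_le_add_sum_exp {f : (Fin n → ℝ) → 𝕜} {M ε δ θ : ℝ} {x y : Fin n → ℝ}
    (hM : ∀ y, ‖f y‖ ≤ M) (hε : 0 ≤ ε) (hθ : 0 ≤ θ)
    (h : (∀ j, |y j ^ 2 - x j ^ 2| < δ) → ‖f y - f x‖ ≤ ε) :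
    ‖f y - f x‖ ≤ ε + ∑ j, 2 * M * Real.exp (-(θ * δ)) *
      (Real.exp (θ * (y j ^ 2 - x j ^ 2)) + Real.exp (-θ * (y j ^ 2 - x j ^ 2))) := by
  have hM0 : 0 ≤ M := (norm_nonneg _).trans (hM x)
  have hnn : ∀ j ∈ Finset.univ, 0 ≤ 2 * M * Real.exp (-(θ * δ)) *
      (Real.exp (θ * (y j ^ 2 - x j ^ 2)) + Real.exp (-θ * (y j ^ 2 - x j ^ 2))) :=
    fun j _ => by positivity
  by_cases hc : ∀ j, |y j ^ 2 - x j ^ 2| < δ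
  · linarith [h hc, Finset.sum_nonneg hnn]
  push Not at hc
  obtain ⟨j, hj⟩ := hc
  have h1 := Finset.single_le_sum hnn (Finset.mem_univ j)
  have h2 : ‖f y - f x‖ ≤ 2 * M := (norm_sub_le _ _).trans (by linarith [hM y, hM x])
  have h3 : 1 ≤ Real.exp (-(θ * δ)) *
      (Real.exp (θ * (y j ^ 2 - x j ^ 2)) + Real.exp (-θ * (y j ^ 2 - x j ^ 2))) := by
    rw [mul_add, ← Real.exp_add, ← Real.exp_add]
    rcases le_abs.1 hj with h4 | h4
    · have : 1 ≤ Real.exp (-(θ * δ) + θ * (y j ^ 2 - x j ^ 2)) := Real.one_le_exp (by nlinarith)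
      linarith [Real.exp_pos (-(θ * δ) + -θ * (y j ^ 2 - x j ^ 2))]
    · have : 1 ≤ Real.exp (-(θ * δ) + -θ * (y j ^ 2 - x j ^ 2)) := Real.one_le_exp (by nlinarith)
      linarith [Real.exp_pos (-(θ * δ) + θ * (y j ^ 2 - x j ^ 2))]
  have h5 : 2 * M * 1 ≤ 2 * M * (Real.exp (-(θ * δ)) *
      (Real.exp (θ * (y j ^ 2 - x j ^ 2)) + Real.exp (-θ * (y j ^ 2 - x j ^ 2)))) := by gcongr
  rw [← mul_assoc] at h5
  linarith

/-- Neighbourhoods are measured by squares to match the moments. As `|y² - x²| = |y - x| (y + x)`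
and the coordinates of `x` stay above some `m > 0`, closeness of squares implies closeness of
points. -/
theorem exists_sq_sub_sq_lt_imp {f : (Fin n → ℝ) → 𝕜} {x : Fin n → ℝ} (hx : ∀ j, 0 < x j)
    (hf : ContinuousAt f x) {ε : ℝ} (hε : 0 < ε) :
    ∃ δ > 0, ∀ y : Fin n → ℝ, (∀ j, 0 < y j) → (∀ j, |y j ^ 2 - x j ^ 2| < δ) →
      ‖f y - f x‖ ≤ ε := by
  obtain ⟨η, hη, h⟩ := Metric.continuousAt_iff.1 hf ε hε
  obtain ⟨m, hm, hm0⟩ := ((eventually_all.2 fun j =>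
    (nhdsWithin_le_nhds (Iio_mem_nhds (hx j)) : ∀ᶠ m in 𝓝[>] (0 : ℝ), m < x j)).and
      self_mem_nhdsWithin).exists
  replace hm0 : 0 < m := hm0
  refine ⟨η * m, by positivity, fun y hy hxy => ?_⟩
  rw [← dist_eq_norm]
  refine (h ((dist_pi_lt_iff hη).2 fun j => ?_)).le
  have h1 := hxy j
  rw [Real.dist_eq]
  rw [sq_sub_sq, abs_mul, abs_of_pos (by linarith [hy j, hx j])] at h1
  by_contra! h2
  nlinarith [hy j, hm j, hx j]

/-- The Laguerre heat operators are an approximate identity at the points of continuity of a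
bounded function. -/
theorem tendsto_heatOp_of_continuousAt {ι : Type*} {l : Filter ι} {lam x : Fin n → ℝ}
    {s : ι → Fin n → ℝ} (hlam : ∀ j, -(1 / 2 : ℝ) < lam j)
    (hs : ∀ j, Tendsto (fun i => s i j) l (𝓝[>] 0)) (hx : ∀ j, 0 < x j)
    {f : (Fin n → ℝ) → 𝕜} (hf : AEStronglyMeasurable f (mu lam)) {M : ℝ} (hM : ∀ y, ‖f y‖ ≤ M)
    (hc : ContinuousAt f x) :
    Tendsto (fun i => heatOp lam (s i) f x) l (𝓝 (f x)) := by
  have hM0 : 0 ≤ M := (norm_nonneg _).trans (hM x)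
  have hmass : Tendsto (fun i => ∫ y, heatKernelN lam (s i) x y ∂mu lam) l (𝓝 1) := by
    simpa using tendsto_integral_heatKernelN_mul_exp (θ := 0) hlam hs hx
  have hmom : ∀ j (θ : ℝ), Tendsto (fun i => ∫ y, heatKernelN lam (s i) x y *
      Real.exp (θ * (y j ^ 2 - x j ^ 2)) ∂mu lam) l (𝓝 1) := fun j θ => by
    simpa only [prod_exp_single] using
      tendsto_integral_heatKernelN_mul_exp (θ := Pi.single j θ) hlam hs hx
  have hspos : ∀ᶠ i in l, ∀ j, 0 < s i j :=
    eventually_all.2 fun j => (hs j).eventually self_mem_nhdsWithin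
  have hint : ∀ j (θ : ℝ), ∀ᶠ i in l, Integrable (fun y => heatKernelN lam (s i) x y *
      Real.exp (θ * (y j ^ 2 - x j ^ 2))) (mu lam) := fun j θ => by
    have h1 : ∀ᶠ i in l, ∀ j', (Pi.single j θ : Fin n → ℝ) j' < heatRate (s i j') :=
      eventually_all.2 fun j' => (hs j').eventually (eventually_lt_heatRate _)
    filter_upwards [hspos, h1] with i hi h2
    simpa only [prod_exp_single] using integrable_heatKernelN_mul_exp hlam hi hx h2
  suffices h : Tendsto (fun i => heatOp lam (s i) f x -
      (∫ y, heatKernelN lam (s i) x y ∂mu lam) • f x) l (𝓝 0) by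
    have := h.add (hmass.smul_const (f x))
    simpa using this
  rw [Metric.tendsto_nhds]
  intro ε hε
  obtain ⟨δ, hδ, hfδ⟩ := exists_sq_sub_sq_lt_imp hx hc (half_pos hε)
  -- `θ` is fixed before the limit: the tail factor `exp (-θ δ)` is small, and the moments of
  -- parameters `θ` and `-θ` each tend to 1, whence `1 + 1`.
  obtain ⟨θ, hθ0, hθ⟩ : ∃ θ : ℝ, 0 ≤ θ ∧
      ∑ _j : Fin n, 2 * M * Real.exp (-(θ * δ)) * (1 + 1) < ε / 2 := by
    have h1 : Tendsto (fun θ : ℝ => ∑ _j : Fin n, 2 * M * Real.exp (-(θ * δ)) * (1 + 1)) atTop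
        (𝓝 (∑ _j : Fin n, 2 * M * 0 * (1 + 1))) := by
      refine tendsto_finsetSum _ fun j _ => ((Tendsto.const_mul _ ?_).mul_const _)
      exact Real.tendsto_exp_neg_atTop_nhds_zero.comp (tendsto_id.atTop_mul_const hδ)
    simp only [mul_zero, zero_mul, Finset.sum_const_zero] at h1
    exact ((eventually_ge_atTop 0).and (h1.eventually (gt_mem_nhds (half_pos hε)))).exists
  have hlim : Tendsto (fun i => ε / 2 * (∫ y, heatKernelN lam (s i) x y ∂mu lam) +
      ∑ j, 2 * M * Real.exp (-(θ * δ)) *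
        ((∫ y, heatKernelN lam (s i) x y * Real.exp (θ * (y j ^ 2 - x j ^ 2)) ∂mu lam) +
        ∫ y, heatKernelN lam (s i) x y * Real.exp (-θ * (y j ^ 2 - x j ^ 2)) ∂mu lam)) l
      (𝓝 (ε / 2 * 1 + ∑ _j : Fin n, 2 * M * Real.exp (-(θ * δ)) * (1 + 1))) :=
    (hmass.const_mul _).add (tendsto_finsetSum _ fun j _ =>
      ((hmom j θ).add (hmom j (-θ))).const_mul _)
  filter_upwards [hlim.eventually (gt_mem_nhds (show _ < ε by linarith)), hspos,
    eventually_all.2 fun j => hint j θ, eventually_all.2 fun j => hint j (-θ)] with i hi hsi h1 h2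
  have hK := integrable_heatKernelN hlam hsi hx
  rw [dist_zero_right, heatOp, ← integral_smul_const, ← integral_sub
    (integrable_heatKernelN_smul_of_bound hlam hsi hx hf hM) (hK.smul_const _)]
  have hI : ∀ j ∈ Finset.univ, Integrable (fun y => 2 * M * Real.exp (-(θ * δ)) *
      (heatKernelN lam (s i) x y * Real.exp (θ * (y j ^ 2 - x j ^ 2)) +
        heatKernelN lam (s i) x y * Real.exp (-θ * (y j ^ 2 - x j ^ 2)))) (mu lam) :=
    fun j _ => ((h1 j).add (h2 j)).const_mul _
  refine lt_of_le_of_lt (norm_integral_le_of_norm_le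
    (g := fun y => ε / 2 * heatKernelN lam (s i) x y + ∑ j, 2 * M * Real.exp (-(θ * δ)) *
      (heatKernelN lam (s i) x y * Real.exp (θ * (y j ^ 2 - x j ^ 2)) +
        heatKernelN lam (s i) x y * Real.exp (-θ * (y j ^ 2 - x j ^ 2))))
    ((hK.const_mul _).add (integrable_finsetSum _ hI)) ?_) ?_
  · filter_upwards [ae_mu_pos lam] with y hy
    have h0 := heatKernelN_nonneg hlam hsi hx hy
    rw [← smul_sub, norm_smul, Real.norm_of_nonneg h0]
    refine (mul_le_mul_of_nonneg_left (norm_sub_le_add_sum_exp hM (half_pos hε).le hθ0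
      (hfδ y hy)) h0).trans (le_of_eq ?_)
    rw [mul_add, Finset.mul_sum]
    congr 1
    · ring
    · exact Finset.sum_congr rfl fun j _ => by ring
  · rw [integral_add (hK.const_mul _) (integrable_finsetSum _ hI), integral_const_mul,
      integral_finsetSum _ hI]
    simp only [integral_const_mul, integral_add (h1 _) (h2 _)]
    exact hi

/-! ### Boxes and the weak type (1,1) inequality. -/

/-- The open box with centre `x` and half-widths `R`. -/
def box (x R : Fin n → ℝ) : Set (Fin n → ℝ) :=
  Set.univ.pi fun j => Set.Ioo (x j - R j) (x j + R j)

/-- The quantity comparable to the `mu lam`-measure of `box x R`. -/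
noncomputable def boxVol (lam x R : Fin n → ℝ) : ℝ := ∏ j, vol (lam j) (x j) (R j)

theorem mem_box {x R y : Fin n → ℝ} : y ∈ box x R ↔ ∀ j, |x j - y j| < R j := by
  simp only [box, Set.mem_univ_pi, Set.mem_Ioo, abs_lt]
  refine forall_congr' fun j => ⟨fun h => ⟨by linarith, by linarith⟩, fun h => ⟨by linarith, by linarith⟩⟩

theorem isOpen_box (x R : Fin n → ℝ) : IsOpen (box x R) :=
  isOpen_set_pi Set.finite_univ fun _ _ => isOpen_Ioo

theorem boxVol_pos {lam x R : Fin n → ℝ} (hx : ∀ j, 0 < x j) (hR : ∀ j, 0 < R j) :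
    0 < boxVol lam x R :=
  Finset.prod_pos fun j _ => vol_pos (hx j) (hR j)

theorem exists_mu_box_le {lam : Fin n → ℝ} (hlam : ∀ j, -(1 / 2 : ℝ) < lam j) :
    ∃ C : ℝ, 0 < C ∧ ∀ x R : Fin n → ℝ, (∀ j, 0 < x j) → (∀ j, 0 < R j) →
      mu lam (box x fun j => 3 * R j) ≤ ENNReal.ofReal (C * boxVol lam x R) := by
  choose C hC h using fun j => exists_measureOne_Ioo_le (hlam j)
  refine ⟨∏ j, C j, Finset.prod_pos fun j _ => hC j, fun x R hx hR => ?_⟩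
  rw [box, mu, Measure.pi_pi, boxVol, ← Finset.prod_mul_distrib,
    ENNReal.ofReal_prod_of_nonneg fun j _ => (mul_pos (hC j) (vol_pos (hx j) (hR j))).le]
  exact Finset.prod_le_prod' fun j _ => h j (x j) (R j) (hx j) (hR j)

/-- Vitali selection controls only the product of the sides; for ordered boxes this controls each
side. -/
theorem le_two_mul_of_prod_le {a b : Fin n → ℝ} (hb : ∀ j, 0 < b j) (hba : ∀ j, b j ≤ a j)
    (h : ∏ j, a j ≤ 2 * ∏ j, b j) (j : Fin n) : a j ≤ 2 * b j := by
  rw [← Finset.mul_prod_erase _ _ (Finset.mem_univ j),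
    ← Finset.mul_prod_erase _ b (Finset.mem_univ j)] at h
  have hP : 0 < ∏ i ∈ Finset.univ.erase j, b i := Finset.prod_pos fun i _ => hb i
  have hle : ∏ i ∈ Finset.univ.erase j, b i ≤ ∏ i ∈ Finset.univ.erase j, a i :=
    Finset.prod_le_prod (fun i _ => (hb i).le) fun i _ => hba i
  have ha : 0 < a j := (hb j).trans_le (hba j)
  refine le_of_mul_le_mul_right ?_ hP
  calc a j * ∏ i ∈ Finset.univ.erase j, b i ≤ a j * ∏ i ∈ Finset.univ.erase j, a i := by gcongr
    _ ≤ _ := h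
    _ = _ := by ring

/-- The weak type `(1, 1)` inequality for the maximal function along a monotone one-parameter
family of boxes. -/
theorem exists_weak_type_boxes {lam : Fin n → ℝ} (hlam : ∀ j, -(1 / 2 : ℝ) < lam j) :
    ∃ C : ℝ, 0 < C ∧ ∀ (ρ : ℝ → Fin n → ℝ), (∀ t ∈ Set.Ioc (0 : ℝ) 1, ∀ j, 0 < ρ t j) →
      (∀ j, MonotoneOn (fun t => ρ t j) (Set.Ioc 0 1)) →
      ∀ (h : (Fin n → ℝ) → ℝ≥0∞) (Λ : ℝ≥0∞),
        Λ * mu lam {x | (∀ j, 0 < x j) ∧ ∃ t ∈ Set.Ioc (0 : ℝ) 1,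
          Λ * ENNReal.ofReal (boxVol lam x (ρ t)) < ∫⁻ y in box x (ρ t), h y ∂mu lam} ≤
        ENNReal.ofReal C * ∫⁻ y, h y ∂mu lam := by
  obtain ⟨C, hC, hbox⟩ := exists_mu_box_le hlam
  refine ⟨C, hC, fun ρ hpos hmono h Λ => ?_⟩
  set T : Set ((Fin n → ℝ) × ℝ) := {a | (∀ j, 0 < a.1 j) ∧ a.2 ∈ Set.Ioc (0 : ℝ) 1 ∧
    Λ * ENNReal.ofReal (boxVol lam a.1 (ρ a.2)) < ∫⁻ y in box a.1 (ρ a.2), h y ∂mu lam} with hT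
  have hcenter : ∀ a ∈ T, a.1 ∈ box a.1 (ρ a.2) := fun a ha =>
    mem_box.2 fun j => by simpa using hpos a.2 ha.2.1 j
  -- The size of a box is the product of its half-widths, bounded by its value at time 1 by
  -- monotonicity.
  obtain ⟨u, huT, hdisj, hcov⟩ := Vitali.exists_disjoint_subfamily_covering_enlargement
    (fun a => box a.1 (ρ a.2)) T (fun a => ∏ j, ρ a.2 j) 2 one_lt_two
    (fun a ha => Finset.prod_nonneg fun j _ => (hpos a.2 ha.2.1 j).le) (∏ j, ρ 1 j)
    (fun a ha => Finset.prod_le_prod (fun j _ => (hpos a.2 ha.2.1 j).le) fun j _ =>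
      hmono j ha.2.1 ⟨one_pos, le_rfl⟩ ha.2.1.2) fun a ha => ⟨a.1, hcenter a ha⟩
  have hcount : u.Countable := hdisj.countable_of_isOpen (fun a _ => isOpen_box _ _)
    fun a ha => ⟨a.1, hcenter a (huT ha)⟩
  have hsub : {x | (∀ j, 0 < x j) ∧ ∃ t ∈ Set.Ioc (0 : ℝ) 1,
      Λ * ENNReal.ofReal (boxVol lam x (ρ t)) < ∫⁻ y in box x (ρ t), h y ∂mu lam} ⊆
      ⋃ b ∈ u, box b.1 fun j => 3 * ρ b.2 j := by
    rintro x ⟨hx, t, ht, hlt⟩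
    obtain ⟨b, hb, ⟨z, hz1, hz2⟩, hδ⟩ := hcov (x, t) ⟨hx, ht, hlt⟩
    have hbT := (huT hb).2.1
    refine Set.mem_biUnion hb (mem_box.2 fun j => ?_)
    have h1 := mem_box.1 hz1 j
    have h2 := mem_box.1 hz2 j
    -- A box from an earlier time is no wider; one from a later time is wider in every direction but
    -- at most twice as large. Only the centre `x` has to be covered, so the dilation factor is `2 +
    -- 1 = 3`.
    have h3 : ρ t j ≤ 2 * ρ b.2 j := by
      rcases le_total t b.2 with hle | hle
      · have h4 := hmono j ht hbT hle
        have h5 := hpos _ hbT j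
        dsimp only at h4
        linarith
      · exact le_two_mul_of_prod_le (hpos _ hbT) (fun j => hmono j hbT ht hle) hδ j
    dsimp only at h1 h2
    rw [abs_lt] at *
    constructor <;> linarith
  have := hcount.to_subtype
  calc Λ * mu lam _ ≤ Λ * ∑' b : u, mu lam (box b.1.1 fun j => 3 * ρ b.1.2 j) := by
        gcongr
        refine (measure_mono hsub).trans ?_
        rw [Set.biUnion_eq_iUnion]
        exact measure_iUnion_le _
    _ ≤ Λ * ∑' b : u, ENNReal.ofReal C * ENNReal.ofReal (boxVol lam b.1.1 (ρ b.1.2)) := by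
        gcongr with b
        rw [← ENNReal.ofReal_mul hC.le]
        exact hbox _ _ (huT b.2).1 (hpos _ (huT b.2).2.1)
    _ = ENNReal.ofReal C * ∑' b : u, Λ * ENNReal.ofReal (boxVol lam b.1.1 (ρ b.1.2)) := by
        rw [ENNReal.tsum_mul_left, ENNReal.tsum_mul_left]
        ring
    _ ≤ ENNReal.ofReal C * ∑' b : u, ∫⁻ y in box b.1.1 (ρ b.1.2), h y ∂mu lam := by
        gcongr with b
        exact (huT b.2).2.2.le
    _ = ENNReal.ofReal C * ∫⁻ y in ⋃ b : u, box b.1.1 (ρ b.1.2), h y ∂mu lam := by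
        rw [lintegral_iUnion (fun b => (isOpen_box _ _).measurableSet)]
        exact hdisj.subtype _ _
    _ ≤ _ := by
        gcongr
        exact Measure.restrict_le_self

/-- Since `k² ≤ 4 ^ k`, the exponent is at most `k log M - k² / 8`, and completing the square gives
the bound. -/
theorem pow_mul_exp_le {M : ℝ} (hM : 1 ≤ M) (k : ℕ) :
    M ^ k * Real.exp (-(4 ^ k / 8)) ≤ Real.exp (2 * Real.log M ^ 2) := by
  have hM0 : 0 < M := by linarith
  have h1 : M ^ k = Real.exp (k * Real.log M) := by
    rw [mul_comm, Real.exp_mul, Real.exp_log hM0, Real.rpow_natCast]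
  have h2 : (k : ℝ) ^ 2 ≤ 4 ^ k := by
    have : (k : ℝ) ≤ 2 ^ k := by exact_mod_cast Nat.lt_two_pow_self.le
    calc (k : ℝ) ^ 2 ≤ (2 ^ k) ^ 2 := by gcongr
      _ = 4 ^ k := by rw [← pow_mul, mul_comm k 2, pow_mul]; norm_num
  rw [h1, ← Real.exp_add, Real.exp_le_exp]
  nlinarith [sq_nonneg ((k : ℝ) - 4 * Real.log M)]

/-- The heat kernel is dominated by a rapidly decreasing combination of normalized indicators of
dilated boxes. -/
theorem exists_heatKernelN_le {lam : Fin n → ℝ} (hlam : ∀ j, -(1 / 2 : ℝ) < lam j) :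
    ∃ D : ℝ, 0 < D ∧ ∀ s x y : Fin n → ℝ, (∀ j, 0 < s j) → (∀ j, 0 < x j) → (∀ j, 0 < y j) →
      ∃ k : ℕ, y ∈ box x (fun j => 2 ^ k * heatWidth (s j)) ∧ heatKernelN lam s x y ≤
        D * (1 / 4) ^ k / boxVol lam x (fun j => 2 ^ k * heatWidth (s j)) := by
  choose C M hC hM h using fun j => exists_heatKernel_le_vol (hlam j)
  have hCpos : 0 < ∏ j, C j := Finset.prod_pos fun j _ => hC j
  have hM1 : 1 ≤ ∏ j, M j := by
    rw [← Finset.prod_const_one (ι := Fin n) (s := Finset.univ)]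
    exact Finset.prod_le_prod (fun _ _ => zero_le_one) fun j _ => hM j
  set P := ∏ j, M j with hP
  refine ⟨(∏ j, C j) * (Real.exp (1 / 8) * Real.exp (2 * Real.log (4 * P) ^ 2)), by positivity,
    fun s x y hs hx hy => ?_⟩
  have hρ : ∀ j, 0 < heatWidth (s j) := fun j => heatWidth_pos (hs j)
  have hex : ∃ k : ℕ, ∀ j, |x j - y j| < 2 ^ k * heatWidth (s j) :=
    (eventually_all.2 fun j => ((tendsto_pow_atTop_atTop_of_one_lt one_lt_two).atTop_mul_const
      (hρ j)).eventually (eventually_gt_atTop _)).exists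
  classical
  obtain ⟨k, hk, hexp⟩ : ∃ k : ℕ, (∀ j, |x j - y j| < 2 ^ k * heatWidth (s j)) ∧
      ∏ j, Real.exp (-(((x j - y j) / heatWidth (s j)) ^ 2 / 2)) ≤
        Real.exp (1 / 8) * Real.exp (-(4 ^ k / 8)) := by
    -- The least `k` is taken: if `k = m + 1`, some coordinate lies outside the box of index `m`,
    -- and its Gaussian factor is at most `exp (-4 ^ m / 2) = exp (-4 ^ k / 8)`. The factor `exp (1
    -- / 8)` covers `k = 0`.
    refine ⟨Nat.find hex, Nat.find_spec hex, ?_⟩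
    rw [← Real.exp_sum, ← Real.exp_add, Real.exp_le_exp, Finset.sum_neg_distrib]
    have hnn : ∀ j ∈ Finset.univ, 0 ≤ ((x j - y j) / heatWidth (s j)) ^ 2 / 2 :=
      fun j _ => by positivity
    rcases hcase : Nat.find hex with _ | m
    · have := Finset.sum_nonneg hnn
      norm_num
      exact this
    · have hm := Nat.find_min hex (m := m) (by omega)
      push Not at hm
      obtain ⟨j, hj⟩ := hm
      have h1 := Finset.single_le_sum hnn (Finset.mem_univ j)
      have h2 : (4 : ℝ) ^ m ≤ ((x j - y j) / heatWidth (s j)) ^ 2 := by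
        rw [← sq_abs, abs_div, abs_of_pos (hρ j)]
        calc (4 : ℝ) ^ m = (2 ^ m) ^ 2 := by rw [← pow_mul, mul_comm m 2, pow_mul]; norm_num
          _ ≤ _ := by
            gcongr
            rwa [le_div_iff₀ (hρ j)]
      rw [pow_succ]
      linarith
  refine ⟨k, mem_box.2 hk, ?_⟩
  set R : Fin n → ℝ := fun j => 2 ^ k * heatWidth (s j) with hR
  have hV : 0 < boxVol lam x R := boxVol_pos hx fun j => mul_pos (by positivity) (hρ j)
  calc heatKernelN lam s x y
      ≤ ∏ j, (C j * M j ^ k / vol (lam j) (x j) (R j) *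
          Real.exp (-(((x j - y j) / heatWidth (s j)) ^ 2 / 2))) :=
        Finset.prod_le_prod (fun j _ => heatKernel_nonneg (hlam j) (hs j) (hx j) (hy j))
          fun j _ => h j (s j) (x j) (y j) k (hs j) (hx j) (hy j) (hk j)
    _ = (∏ j, C j) * P ^ k / boxVol lam x R *
          ∏ j, Real.exp (-(((x j - y j) / heatWidth (s j)) ^ 2 / 2)) := by
        rw [Finset.prod_mul_distrib, Finset.prod_div_distrib, Finset.prod_mul_distrib,
          Finset.prod_pow, boxVol]
    _ ≤ (∏ j, C j) * P ^ k / boxVol lam x R * (Real.exp (1 / 8) * Real.exp (-(4 ^ k / 8))) := by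
        gcongr
    _ = (∏ j, C j) * (Real.exp (1 / 8) * ((4 * P) ^ k * Real.exp (-(4 ^ k / 8)))) * (1 / 4) ^ k /
          boxVol lam x R := by
        rw [mul_pow, show (1 / 4 : ℝ) ^ k = (4 ^ k)⁻¹ by rw [one_div, inv_pow]]
        field_simp
    _ ≤ _ := by
        gcongr
        exact pow_mul_exp_le (by linarith) k

/-- The weak type `(1, 1)` inequality for the maximal operator of the Laguerre heat operators along
a monotone curve of times. -/
theorem exists_weak_type_heatKernelN {lam : Fin n → ℝ} (hlam : ∀ j, -(1 / 2 : ℝ) < lam j)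
    {r : ℝ → Fin n → ℝ} (hr_mono : ∀ j, MonotoneOn (fun t => r t j) (Set.Ici 0))
    (hr_pos : ∀ j, ∀ t : ℝ, 0 < t → 0 < r t j) :
    ∃ C : ℝ, 0 < C ∧ ∀ (h : (Fin n → ℝ) → ℝ≥0∞), AEMeasurable h (mu lam) → ∀ Λ : ℝ, 0 < Λ →
      mu lam {x | (∀ j, 0 < x j) ∧ ∃ t ∈ Set.Ioc (0 : ℝ) 1, ENNReal.ofReal Λ <
        ∫⁻ y, ENNReal.ofReal (heatKernelN lam (r t) x y) * h y ∂mu lam} ≤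
      ENNReal.ofReal (C / Λ) * ∫⁻ y, h y ∂mu lam := by
  obtain ⟨C, hC, hweak⟩ := exists_weak_type_boxes hlam
  obtain ⟨D, hD, hker⟩ := exists_heatKernelN_le hlam
  refine ⟨4 * D * C, by positivity, fun h hh Λ hΛ => ?_⟩
  set ρ : ℕ → ℝ → Fin n → ℝ := fun k t j => 2 ^ k * heatWidth (r t j) with hρ
  have hρpos : ∀ k, ∀ t ∈ Set.Ioc (0 : ℝ) 1, ∀ j, 0 < ρ k t j := fun k t ht j =>
    mul_pos (by positivity) (heatWidth_pos (hr_pos j t ht.1))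
  have hρmono : ∀ k j, MonotoneOn (fun t => ρ k t j) (Set.Ioc 0 1) := fun k j a ha b hb hab =>
    mul_le_mul_of_nonneg_left (heatWidth_mono (hr_pos j a ha.1)
      (hr_mono j ha.1.le hb.1.le hab)) (by positivity)
  -- Levels growing like `2 ^ k` make both series converge: `∑ D 4 ^ (-k) L k = Λ`, and `∑ (L k)⁻¹`
  -- is finite.
  set L : ℕ → ℝ := fun k => Λ * 2 ^ k / (2 * D) with hL
  have hLpos : ∀ k, 0 < L k := fun k => by positivity
  set E : ℕ → Set (Fin n → ℝ) := fun k => {x | (∀ j, 0 < x j) ∧ ∃ t ∈ Set.Ioc (0 : ℝ) 1,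
    ENNReal.ofReal (L k) * ENNReal.ofReal (boxVol lam x (ρ k t)) <
      ∫⁻ y in box x (ρ k t), h y ∂mu lam} with hE
  have hgeom : HasSum (fun k : ℕ => ((1 : ℝ) / 2) ^ k) 2 := hasSum_geometric_two
  have hsub : {x | (∀ j, 0 < x j) ∧ ∃ t ∈ Set.Ioc (0 : ℝ) 1, ENNReal.ofReal Λ <
      ∫⁻ y, ENNReal.ofReal (heatKernelN lam (r t) x y) * h y ∂mu lam} ⊆ ⋃ k, E k := by
    rintro x ⟨hx, t, ht, hlt⟩
    by_contra hcon
    have hcon' : ∀ k, ∫⁻ y in box x (ρ k t), h y ∂mu lam ≤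
        ENNReal.ofReal (L k) * ENNReal.ofReal (boxVol lam x (ρ k t)) := fun k => by
      by_contra hk
      exact hcon (Set.mem_iUnion.2 ⟨k, hx, t, ht, not_le.1 hk⟩)
    have hrt : ∀ j, 0 < r t j := fun j => hr_pos j t ht.1
    have hV : ∀ k, 0 < boxVol lam x (ρ k t) := fun k => boxVol_pos hx (hρpos k t ht)
    refine hlt.not_ge ?_
    calc ∫⁻ y, ENNReal.ofReal (heatKernelN lam (r t) x y) * h y ∂mu lam
        ≤ ∫⁻ y, ∑' k, ENNReal.ofReal (D * (1 / 4) ^ k / boxVol lam x (ρ k t)) *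
            (box x (ρ k t)).indicator h y ∂mu lam := by
          refine lintegral_mono_ae ?_
          filter_upwards [ae_mu_pos lam] with y hy
          obtain ⟨k, hyk, hk⟩ := hker (r t) x y hrt hx hy
          refine le_trans ?_ (ENNReal.le_tsum k)
          rw [Set.indicator_of_mem hyk]
          gcongr
      _ = ∑' k, ENNReal.ofReal (D * (1 / 4) ^ k / boxVol lam x (ρ k t)) *
            ∫⁻ y in box x (ρ k t), h y ∂mu lam := by
          rw [lintegral_tsum fun k =>
            (hh.indicator (isOpen_box _ _).measurableSet).const_mul _]
          congr 1
          ext k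
          rw [lintegral_const_mul'' _ (hh.indicator (isOpen_box _ _).measurableSet),
            lintegral_indicator (isOpen_box _ _).measurableSet]
      _ ≤ ∑' k : ℕ, ENNReal.ofReal (Λ / 2 * (1 / 2) ^ k) := by
          refine ENNReal.tsum_le_tsum fun k => ?_
          refine (mul_le_mul_right (hcon' k) _).trans (le_of_eq ?_)
          have hVk := hV k
          rw [← ENNReal.ofReal_mul (hLpos k).le, ← ENNReal.ofReal_mul (by positivity)]
          congr 1
          simp only [hL]
          rw [show (1 / 4 : ℝ) = 1 / 2 * (1 / 2) by norm_num, mul_pow]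
          have : (2 : ℝ) ^ k * (1 / 2) ^ k = 1 := by rw [← mul_pow]; norm_num
          calc D * ((1 / 2) ^ k * (1 / 2) ^ k) / boxVol lam x (ρ k t) *
                (Λ * 2 ^ k / (2 * D) * boxVol lam x (ρ k t))
              = Λ / 2 * (1 / 2) ^ k * (2 ^ k * (1 / 2) ^ k) := by field_simp
            _ = _ := by rw [this, mul_one]
      _ = ENNReal.ofReal Λ := by
          rw [← ENNReal.ofReal_tsum_of_nonneg (fun k => by positivity)
            (hgeom.mul_left _).summable, (hgeom.mul_left _).tsum_eq]
          congr 1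
          ring
  have hEk : ∀ k, mu lam (E k) ≤
      ENNReal.ofReal (2 * D / Λ * (1 / 2) ^ k) * (ENNReal.ofReal C * ∫⁻ y, h y ∂mu lam) := by
    intro k
    have h1 := hweak (ρ k) (hρpos k) (hρmono k) h (ENNReal.ofReal (L k))
    have h2 : 2 * D / Λ * (1 / 2) ^ k = (L k)⁻¹ := by
      simp only [hL]
      rw [one_div, inv_pow]
      field_simp
    rw [h2, ENNReal.ofReal_inv_of_pos (hLpos k), mul_comm, ← div_eq_mul_inv,
      ENNReal.le_div_iff_mul_le (Or.inl (by simpa using hLpos k))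
      (Or.inl ENNReal.ofReal_ne_top), mul_comm]
    exact h1
  calc mu lam _ ≤ ∑' k, mu lam (E k) := (measure_mono hsub).trans (measure_iUnion_le _)
    _ ≤ ∑' k : ℕ, ENNReal.ofReal (2 * D / Λ * (1 / 2) ^ k) *
          (ENNReal.ofReal C * ∫⁻ y, h y ∂mu lam) := ENNReal.tsum_le_tsum hEk
    _ = ENNReal.ofReal (4 * D * C / Λ) * ∫⁻ y, h y ∂mu lam := by
        rw [ENNReal.tsum_mul_right, ← ENNReal.ofReal_tsum_of_nonneg (fun k => by positivity)
          (hgeom.mul_left _).summable, (hgeom.mul_left _).tsum_eq, ← mul_assoc,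
          ← ENNReal.ofReal_mul (by positivity)]
        congr 2
        ring

/-! ### Absolute convergence and size of the heat operators on `L¹`. -/

/-- With `2 * lam` possibly negative, `vol` is written as `R / (u + R)` times `(u + R) ^ (2 * lam +
1)`; both factors increase with `R`. The lower bound is uniform over dilations, hence bounds the
kernel in `y`. -/
theorem le_vol {lam u R₀ R : ℝ} (hlam : -(1 / 2 : ℝ) < lam) (hu : 0 < u) (hR₀ : 0 < R₀)
    (hR : R₀ ≤ R) : R₀ / (u + R₀) * u ^ (2 * lam + 1) ≤ vol lam u R := by
  have hRpos : 0 < R := hR₀.trans_le hR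
  have h1 : R₀ / (u + R₀) ≤ R / (u + R) := by
    rw [div_le_div_iff₀ (by positivity) (by positivity)]
    nlinarith
  have h2 : u ^ (2 * lam + 1) ≤ (u + R) ^ (2 * lam + 1) :=
    Real.rpow_le_rpow hu.le (by linarith) (by linarith)
  calc R₀ / (u + R₀) * u ^ (2 * lam + 1) ≤ R / (u + R) * (u + R) ^ (2 * lam + 1) := by gcongr
    _ = vol lam u R := by
      rw [vol, Real.rpow_add_one (by positivity)]
      field_simp

theorem exists_heatKernelN_le_const {lam s x : Fin n → ℝ} (hlam : ∀ j, -(1 / 2 : ℝ) < lam j)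
    (hs : ∀ j, 0 < s j) (hx : ∀ j, 0 < x j) :
    ∃ B : ℝ, ∀ y : Fin n → ℝ, (∀ j, 0 < y j) → heatKernelN lam s x y ≤ B := by
  obtain ⟨D, hD, h⟩ := exists_heatKernelN_le hlam
  set c : ℝ := ∏ j, heatWidth (s j) / (x j + heatWidth (s j)) * x j ^ (2 * lam j + 1) with hc
  have hcj : ∀ j, 0 < heatWidth (s j) / (x j + heatWidth (s j)) * x j ^ (2 * lam j + 1) := fun j => by
    have := heatWidth_pos (hs j)
    have := hx j
    positivity
  have hc0 : 0 < c := Finset.prod_pos fun j _ => hcj j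
  refine ⟨D / c, fun y hy => ?_⟩
  obtain ⟨k, -, hk⟩ := h s x y hs hx hy
  have hle : c ≤ boxVol lam x fun j => 2 ^ k * heatWidth (s j) :=
    Finset.prod_le_prod (fun j _ => (hcj j).le) fun j _ =>
      le_vol (hlam j) (hx j) (heatWidth_pos (hs j))
        (le_mul_of_one_le_left (heatWidth_pos (hs j)).le (one_le_pow₀ one_le_two))
  refine hk.trans (div_le_div₀ hD.le ?_ hc0 hle)
  exact mul_le_of_le_one_right hD.le (pow_le_one₀ (by norm_num) (by norm_num))

theorem integrable_heatKernelN_smul {lam s x : Fin n → ℝ} (hlam : ∀ j, -(1 / 2 : ℝ) < lam j)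
    (hs : ∀ j, 0 < s j) (hx : ∀ j, 0 < x j) {f : (Fin n → ℝ) → 𝕜} (hf : Integrable f (mu lam)) :
    Integrable (fun y => heatKernelN lam s x y • f y) (mu lam) := by
  obtain ⟨B, hB⟩ := exists_heatKernelN_le_const hlam hs hx
  refine (hf.norm.const_mul B).mono'
    ((integrable_heatKernelN hlam hs hx).aestronglyMeasurable.smul hf.aestronglyMeasurable) ?_
  filter_upwards [ae_mu_pos lam] with y hy
  rw [norm_smul, Real.norm_of_nonneg (heatKernelN_nonneg hlam hs hx hy)]
  exact mul_le_mul_of_nonneg_right (hB y hy) (norm_nonneg _)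

theorem heatOp_add {lam s x : Fin n → ℝ} {f g : (Fin n → ℝ) → 𝕜}
    (hf : Integrable (fun y => heatKernelN lam s x y • f y) (mu lam))
    (hg : Integrable (fun y => heatKernelN lam s x y • g y) (mu lam)) :
    heatOp lam s (f + g) x = heatOp lam s f x + heatOp lam s g x := by
  simp only [heatOp, Pi.add_apply, smul_add]
  exact integral_add hf hg

theorem enorm_heatOp_le {lam s x : Fin n → ℝ} (hlam : ∀ j, -(1 / 2 : ℝ) < lam j)
    (hs : ∀ j, 0 < s j) (hx : ∀ j, 0 < x j) (f : (Fin n → ℝ) → 𝕜) :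
    ‖heatOp lam s f x‖ₑ ≤ ∫⁻ y, ENNReal.ofReal (heatKernelN lam s x y) * ‖f y‖ₑ ∂mu lam := by
  refine (enorm_integral_le_lintegral_enorm _).trans (lintegral_mono_ae ?_)
  filter_upwards [ae_mu_pos lam] with y hy
  rw [enorm_smul, Real.enorm_of_nonneg (heatKernelN_nonneg hlam hs hx hy)]

/-! ### Almost everywhere convergence. -/

/-- Almost everywhere convergence of the Laguerre heat operators on `L¹`. -/
theorem ae_tendsto_heatOp_of_integrable {lam : Fin n → ℝ} (hlam : ∀ j, -(1 / 2 : ℝ) < lam j)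
    {r : ℝ → Fin n → ℝ} (hr_mono : ∀ j, MonotoneOn (fun t => r t j) (Set.Ici 0))
    (hr_pos : ∀ j, ∀ t : ℝ, 0 < t → 0 < r t j)
    (hr : ∀ j, Tendsto (fun t => r t j) (𝓝[>] 0) (𝓝[>] 0))
    {f : (Fin n → ℝ) → 𝕜} (hf : Integrable f (mu lam)) :
    ∀ᵐ x ∂mu lam, Tendsto (fun t => heatOp lam (r t) f x) (𝓝[>] (0 : ℝ)) (𝓝 (f x)) := by
  have := isLocallyFiniteMeasure_mu hlam
  obtain ⟨C, hC, hweak⟩ := exists_weak_type_heatKernelN hlam hr_mono hr_pos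
  have key : ∀ ε : ℝ, 0 < ε → ∀ᵐ x ∂mu lam, (∀ j, 0 < x j) →
      ∀ᶠ t in 𝓝[>] (0 : ℝ), ‖heatOp lam (r t) f x - f x‖ ≤ 3 * ε := by
    intro ε hε
    have hε' : ENNReal.ofReal ε ≠ 0 := by simpa using hε
    -- Approximating `f` within `1 / m` in `L¹` by a continuous `g` bounds the outer measure of the
    -- exceptional set; for `m = 0` the bound is infinite.
    have hbound : ∀ m : ℕ, mu lam {x | ¬ ((∀ j, 0 < x j) →
        ∀ᶠ t in 𝓝[>] (0 : ℝ), ‖heatOp lam (r t) f x - f x‖ ≤ 3 * ε)} ≤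
        (ENNReal.ofReal (C / ε) + (ENNReal.ofReal ε)⁻¹) * (m : ℝ≥0∞)⁻¹ := by
      intro m
      obtain ⟨g, hgs, hfg, hgc, hgi⟩ := hf.exists_hasCompactSupport_lintegral_sub_le
        (ε := (m : ℝ≥0∞)⁻¹) (by simp)
      obtain ⟨M, hM⟩ := hgs.exists_bound_of_continuous hgc
      have hd : AEMeasurable (fun y => ‖f y - g y‖ₑ) (mu lam) :=
        (hf.sub hgi).aestronglyMeasurable.enorm
      have hE1 := hweak (fun y => ‖f y - g y‖ₑ) hd ε hε
      have hE2 := meas_ge_le_lintegral_div hd hε' ENNReal.ofReal_ne_top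
      -- Off this union, the maximal term for `f - g`, the convergence error for `g` and `f - g` at
      -- `x` cost at most `ε` each.
      refine (measure_mono (t := {x | (∀ j, 0 < x j) ∧ ∃ t ∈ Set.Ioc (0 : ℝ) 1, ENNReal.ofReal ε <
        ∫⁻ y, ENNReal.ofReal (heatKernelN lam (r t) x y) * ‖f y - g y‖ₑ ∂mu lam} ∪
        {x | ENNReal.ofReal ε ≤ ‖f x - g x‖ₑ}) ?_).trans ((measure_union_le _ _).trans ?_)
      · intro x hx
        by_contra hcon
        simp only [Set.mem_union, Set.mem_ofPred_eq, not_or, not_and, not_exists, not_lt,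
          not_le] at hcon
        refine hx fun hxpos => ?_
        have h1 := hcon.1 hxpos
        have h2 : ‖f x - g x‖ < ε := by
          have := hcon.2
          rwa [← ofReal_norm, ENNReal.ofReal_lt_ofReal_iff hε] at this
        have h3 := tendsto_heatOp_of_continuousAt hlam hr hxpos hgc.aestronglyMeasurable hM
          hgc.continuousAt
        filter_upwards [h3.eventually (Metric.ball_mem_nhds _ hε),
          Ioc_mem_nhdsGT (zero_lt_one (α := ℝ))] with t ht3 ht
        have hrt : ∀ j, 0 < r t j := fun j => hr_pos j t ht.1
        have h4 : heatOp lam (r t) f x = heatOp lam (r t) (f - g) x + heatOp lam (r t) g x := by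
          rw [← heatOp_add (integrable_heatKernelN_smul hlam hrt hxpos (hf.sub hgi))
            (integrable_heatKernelN_smul hlam hrt hxpos hgi), sub_add_cancel]
        have h5 : ‖heatOp lam (r t) (f - g) x‖ ≤ ε := by
          have := (enorm_heatOp_le hlam hrt hxpos (f - g)).trans (h1 t ht)
          rwa [← ofReal_norm, ENNReal.ofReal_le_ofReal_iff hε.le] at this
        replace ht3 : ‖heatOp lam (r t) g x - g x‖ < ε := dist_eq_norm (heatOp lam (r t) g x) _ ▸ ht3
        calc ‖heatOp lam (r t) f x - f x‖ = ‖heatOp lam (r t) (f - g) x +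
              (heatOp lam (r t) g x - g x) - (f x - g x)‖ := by
              rw [h4]
              congr 1
              ring
          _ ≤ ‖heatOp lam (r t) (f - g) x‖ + ‖heatOp lam (r t) g x - g x‖ + ‖f x - g x‖ :=
              (norm_sub_le _ _).trans (by gcongr; exact norm_add_le _ _)
          _ ≤ 3 * ε := by linarith
      · rw [add_mul]
        gcongr
        · exact hE1.trans (by gcongr)
        · refine hE2.trans ?_
          rw [ENNReal.div_eq_inv_mul]
          gcongr
    have hlim : Tendsto (fun m : ℕ => (ENNReal.ofReal (C / ε) + (ENNReal.ofReal ε)⁻¹) *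
        (m : ℝ≥0∞)⁻¹) atTop (𝓝 0) := by
      have := ENNReal.Tendsto.const_mul (a := ENNReal.ofReal (C / ε) + (ENNReal.ofReal ε)⁻¹)
        ENNReal.tendsto_inv_nat_nhds_zero
        (Or.inr (by simp [hε]))
      simpa using this
    exact le_antisymm (ge_of_tendsto' hlim hbound) zero_le
  have hall : ∀ᵐ x ∂mu lam, ∀ m : ℕ, (∀ j, 0 < x j) →
      ∀ᶠ t in 𝓝[>] (0 : ℝ), ‖heatOp lam (r t) f x - f x‖ ≤ 3 * (1 / (m + 1 : ℝ)) :=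
    ae_all_iff.2 fun m => key _ Nat.one_div_pos_of_nat
  filter_upwards [hall, ae_mu_pos lam] with x hx hxpos
  rw [Metric.tendsto_nhds]
  intro ε hε
  obtain ⟨m, hm⟩ := exists_nat_one_div_lt (show 0 < ε / 3 by positivity)
  filter_upwards [hx m hxpos] with t ht
  rw [dist_eq_norm]
  linarith

theorem tendsto_heatOp_add {ι : Type*} {l : Filter ι} {lam x : Fin n → ℝ} {s : ι → Fin n → ℝ}
    {f g : (Fin n → ℝ) → 𝕜}
    (hfi : ∀ᶠ i in l, Integrable (fun y => heatKernelN lam (s i) x y • f y) (mu lam))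
    (hgi : ∀ᶠ i in l, Integrable (fun y => heatKernelN lam (s i) x y • g y) (mu lam))
    (hf : Tendsto (fun i => heatOp lam (s i) f x) l (𝓝 (f x)))
    (hg : Tendsto (fun i => heatOp lam (s i) g x) l (𝓝 (g x))) :
    Tendsto (fun i => heatOp lam (s i) (f + g) x) l (𝓝 ((f + g) x)) := by
  refine (hf.add hg).congr' ?_
  filter_upwards [hfi, hgi] with i h1 h2
  exact (heatOp_add h1 h2).symm

/-- Almost everywhere convergence of the Laguerre heat operators on `L^∞`. -/
theorem ae_tendsto_heatOp_of_bound {lam : Fin n → ℝ} (hlam : ∀ j, -(1 / 2 : ℝ) < lam j)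
    {r : ℝ → Fin n → ℝ} (hr_mono : ∀ j, MonotoneOn (fun t => r t j) (Set.Ici 0))
    (hr_pos : ∀ j, ∀ t : ℝ, 0 < t → 0 < r t j)
    (hr : ∀ j, Tendsto (fun t => r t j) (𝓝[>] 0) (𝓝[>] 0))
    {f : (Fin n → ℝ) → 𝕜} (hf : AEStronglyMeasurable f (mu lam)) {M : ℝ} (hM : ∀ y, ‖f y‖ ≤ M) :
    ∀ᵐ x ∂mu lam, Tendsto (fun t => heatOp lam (r t) f x) (𝓝[>] (0 : ℝ)) (𝓝 (f x)) := by
  have := isLocallyFiniteMeasure_mu hlam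
  set B : ℕ → Set (Fin n → ℝ) := fun N => Metric.ball 0 N with hB
  have hBm : ∀ N, MeasurableSet (B N) := fun N => Metric.isOpen_ball.measurableSet
  have hint : ∀ N, Integrable ((B N).indicator f) (mu lam) := fun N =>
    (integrable_indicator_iff (hBm N)).2 (Measure.integrableOn_of_bounded
      measure_ball_lt_top.ne hf (Eventually.of_forall hM))
  have hout : ∀ N y, ‖(B N)ᶜ.indicator f y‖ ≤ M := fun N y =>
    (norm_indicator_le_norm_self _ _).trans (hM y)
  filter_upwards [ae_mu_pos lam, ae_all_iff.2 fun N =>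
    ae_tendsto_heatOp_of_integrable hlam hr_mono hr_pos hr (hint N)] with x hx hxN
  obtain ⟨N, hN⟩ := exists_nat_gt ‖x‖
  have hxB : x ∈ B N := by simpa [hB] using hN
  -- The outer piece vanishes near `x`, so the result at continuity points applies to it without
  -- integrability.
  have hcont : ContinuousAt ((B N)ᶜ.indicator f) x := by
    refine (continuousAt_const (y := (0 : 𝕜))).congr ?_
    filter_upwards [Metric.isOpen_ball.mem_nhds hxB] with y hy
    simp [show y ∈ B N from hy]
  have hpos : ∀ᶠ t in 𝓝[>] (0 : ℝ), ∀ j, 0 < r t j := by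
    filter_upwards [self_mem_nhdsWithin] with t ht j using hr_pos j t ht
  have h := tendsto_heatOp_add
    (hpos.mono fun t ht => integrable_heatKernelN_smul hlam ht hx (hint N))
    (hpos.mono fun t ht => integrable_heatKernelN_smul_of_bound hlam ht hx
      (hf.indicator (hBm N).compl) (hout N)) (hxN N)
    (tendsto_heatOp_of_continuousAt hlam hr hx (hf.indicator (hBm N).compl) (hout N) hcont)
  rwa [Set.indicator_self_add_compl] at h

/-- Every function in `L^p`, `1 ≤ p < ∞`, is the sum of an integrable and a bounded function. -/
theorem exists_integrable_add_bounded {α : Type*} [MeasurableSpace α] {μ : Measure α} {p : ℝ≥0∞}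
    (hp_one : 1 ≤ p) (hp_top : p < ∞) {f : α → 𝕜} (hf : MemLp f p μ) :
    ∃ g b : α → 𝕜, f = g + b ∧ Integrable g μ ∧ AEStronglyMeasurable b μ ∧ ∀ y, ‖b y‖ ≤ 1 := by
  set S : Set α := {y | 1 < ‖f y‖} with hS
  have hSm : NullMeasurableSet S μ :=
    nullMeasurableSet_lt aemeasurable_const hf.1.norm.aemeasurable
  have hp : 1 ≤ p.toReal := by
    rw [← ENNReal.toReal_one]
    exact ENNReal.toReal_mono hp_top.ne hp_one
  refine ⟨S.indicator f, Sᶜ.indicator f, (Set.indicator_self_add_compl S f).symm,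
    (hf.integrable_norm_rpow (one_pos.trans_le hp_one).ne' hp_top.ne).mono'
      (hf.1.indicator₀ hSm) (Eventually.of_forall fun y => ?_), hf.1.indicator₀ hSm.compl,
    fun y => ?_⟩
  · by_cases hy : y ∈ S
    · rw [Set.indicator_of_mem hy]
      have h1 : 1 ≤ ‖f y‖ := le_of_lt hy
      -- Where `‖f‖ > 1`, `‖f‖ ≤ ‖f‖ ^ p`, which is integrable.
      simpa using Real.rpow_le_rpow_of_exponent_le h1 hp
    · rw [Set.indicator_of_notMem hy, norm_zero]
      positivity
  · by_cases hy : y ∈ S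
    · simp [hy]
    · rw [Set.indicator_of_mem (show y ∈ Sᶜ from hy)]
      exact not_lt.1 hy

end LaguerreHeat

theorem corollary1p4 {𝕜 : Type*} [RCLike 𝕜] (n : ℕ)
    (lam : Fin n → ℝ) (hlam : ∀ j, -(1 / 2 : ℝ) < lam j)
    (r : ℝ → Fin n → ℝ)
    (hr_cont : ∀ j, ContinuousOn (fun t => r t j) (Set.Ici 0))
    (hr_mono : ∀ j, MonotoneOn (fun t => r t j) (Set.Ici 0))
    (hr_zero : ∀ j, r 0 j = 0)
    (hr_pos : ∀ j, ∀ t : ℝ, 0 < t → 0 < r t j)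
    (hr_top : ∀ j, Tendsto (fun t => r t j) atTop atTop)
    (p : ℝ≥0∞) (hp_one : 1 ≤ p) (hp_top : p < ∞)
    (f : (Fin n → ℝ) → 𝕜) (hf : MemLp f p (LaguerreHeat.mu lam)) :
    (∀ t : ℝ, 0 < t → ∀ x : Fin n → ℝ, (∀ j, 0 < x j) →
      Integrable (fun y => LaguerreHeat.heatKernelN lam (r t) x y • f y) (LaguerreHeat.mu lam)) ∧
    (∀ᵐ x ∂(LaguerreHeat.mu lam),
      Tendsto (fun t => LaguerreHeat.heatOp lam (r t) f x) (𝓝[>] (0 : ℝ)) (𝓝 (f x))) := by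
  -- Continuity at 0 gives the limit, and positivity keeps the times in `(0, ∞)`.
  have hr : ∀ j, Tendsto (fun t => r t j) (𝓝[>] 0) (𝓝[>] 0) := fun j => by
    refine tendsto_nhdsWithin_iff.2 ⟨?_, ?_⟩
    · have h := (hr_cont j 0 Set.self_mem_Ici).tendsto
      rw [hr_zero] at h
      exact h.mono_left (nhdsWithin_mono _ Set.Ioi_subset_Ici_self)
    · filter_upwards [self_mem_nhdsWithin] with t ht using hr_pos j t ht
  obtain ⟨g, b, rfl, hg, hb, hb1⟩ :=
    LaguerreHeat.exists_integrable_add_bounded hp_one hp_top hf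
  have hgi : ∀ t : ℝ, 0 < t → ∀ x : Fin n → ℝ, (∀ j, 0 < x j) →
      Integrable (fun y => LaguerreHeat.heatKernelN lam (r t) x y • g y) (LaguerreHeat.mu lam) :=
    fun t ht x hx => LaguerreHeat.integrable_heatKernelN_smul hlam (fun j => hr_pos j t ht) hx hg
  have hbi : ∀ t : ℝ, 0 < t → ∀ x : Fin n → ℝ, (∀ j, 0 < x j) →
      Integrable (fun y => LaguerreHeat.heatKernelN lam (r t) x y • b y) (LaguerreHeat.mu lam) :=
    fun t ht x hx => LaguerreHeat.integrable_heatKernelN_smul_of_bound hlam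
      (fun j => hr_pos j t ht) hx hb hb1
  refine ⟨fun t ht x hx => ?_, ?_⟩
  · simp only [Pi.add_apply, smul_add]
    exact (hgi t ht x hx).add (hbi t ht x hx)
  · filter_upwards [LaguerreHeat.ae_mu_pos lam,
      LaguerreHeat.ae_tendsto_heatOp_of_integrable hlam hr_mono hr_pos hr hg,
      LaguerreHeat.ae_tendsto_heatOp_of_bound hlam hr_mono hr_pos hr hb hb1] with x hx h1 h2
    refine LaguerreHeat.tendsto_heatOp_add ?_ ?_ h1 h2
    · filter_upwards [self_mem_nhdsWithin] with t ht using hgi t ht x hx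
    · filter_upwards [self_mem_nhdsWithin] with t ht using hbi t ht x hx
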